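/- Let $\mathcal K_1(\mathbb R^n)$ be the space of all $\varphi\in C^\infty(\mathbb R^n)$ for which the norms $\nu_k(\varphi)=\sup_{t\in\mathbb R^n,\,|\alpha|\le k}e^{k|t|}|\varphi^{(\alpha)}(t)|$, $k\in\mathbb N_0$, are all finite, with the topology defined by these norms, and let $\mathcal K_1'(\mathbb R^n)$ be its dual, with the strong topology. For $\psi\in\mathcal K_1(\mathbb R^n)$ and $f\in\mathcal K_1'(\mathbb R^n)$ the short-time Fourier transform of $f$ with window $\psi$ is $$V_\psi f(x,z)=\big\langle f(t),\,e^{-2\pi i z\cdot t}\,\overline{\psi(t-x)}\big\rangle_t,\qquad x\in\mathbb R^n,\ z\in\mathbb C^n .$$ For $\lambda\ge 0$ let $\Pi_\lambda=\mathbb R^n+i[-\lambda,\lambda]^n\subset\mathbb C^n$. Let $B'\subset\mathcal K_1'(\mathbb R^n)$ and $\psi\in\mathcal K_1(\mathbb R^n)\setminus\{0\}$. If there are $\eta\in\mathbb R^n$ and $k\in\mathbb N_0$ such that $$\sup_{f\in B',\ (x,\xi)\in\mathbb R^{2n}}e^{-k|x|}(1+|\xi|)^{-k}|V_\psi f(x,\xi+i\eta)|<\infty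 ,$$ then $B'$ is bounded in $\mathcal K_1'(\mathbb R^n)$. Conversely, if $B'$ is bounded in $\mathcal K_1'(\mathbb R^n)$, then there is $k\in\mathbb N_0$ such that, for every $\lambda\ge 0$, $$\sup_{f\in B',\ (x,z)\in\mathbb R^n\times\Pi_\lambda}e^{-k|x|-2\pi x\cdot\operatorname{Im}z}(1+|z|)^{-k}|V_\psi f(x,z)|<\infty .$$ -/

import Mathlib

open scoped ContDiff

noncomputable section

namespace ExpType

/-- The partial derivative `∂_{j 0} ⋯ ∂_{j (m - 1)} φ` at `t`. When `φ` is smooth this is `φ^(α)(t)`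
for the multi-index `α` (of length `|α| = m`) that counts how often each coordinate occurs in `j`,
and each multi-index of length `m` arises from some `j`. -/
def partialDeriv {n m : ℕ} (j : Fin m → Fin n) (φ : EuclideanSpace ℝ (Fin n) → ℂ)
    (t : EuclideanSpace ℝ (Fin n)) : ℂ :=
  iteratedFDeriv ℝ m φ t (fun i => EuclideanSpace.single (j i) (1 : ℝ))

/-- Pairs of a point `t` and a partial derivative of order at most `k`. -/
abbrev NuIndex (n k : ℕ) : Type :=
  EuclideanSpace ℝ (Fin n) × (Σ m : Fin (k + 1), (Fin m → Fin n))

/-- The quantity `e^{k|t|} |φ^(α)(t)|`, whose supremum over `t` and `|α| ≤ k` is `ν_k(φ)`. -/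
def nuTerm {n : ℕ} (k : ℕ) (φ : EuclideanSpace ℝ (Fin n) → ℂ) (p : NuIndex n k) : ℝ :=
  Real.exp (k * ‖p.1‖) * ‖partialDeriv p.2.2 φ p.1‖

/-- Membership in the Hasumi-Silva space: `φ` is smooth and every `ν_k(φ)` is finite. -/
def IsKOne {n : ℕ} (φ : EuclideanSpace ℝ (Fin n) → ℂ) : Prop :=
  ContDiff ℝ ∞ φ ∧ ∀ k : ℕ, BddAbove (Set.range (nuTerm k φ))

lemma nuTerm_nonneg {n k : ℕ} (φ : EuclideanSpace ℝ (Fin n) → ℂ) (p : NuIndex n k) :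
    0 ≤ nuTerm k φ p := by
  unfold nuTerm; positivity

lemma nuTerm_add_le {n k : ℕ} {φ χ : EuclideanSpace ℝ (Fin n) → ℂ} (hφ : ContDiff ℝ ∞ φ)
    (hχ : ContDiff ℝ ∞ χ) (p : NuIndex n k) :
    nuTerm k (φ + χ) p ≤ nuTerm k φ p + nuTerm k χ p := by
  have h : partialDeriv p.2.2 (φ + χ) p.1
      = partialDeriv p.2.2 φ p.1 + partialDeriv p.2.2 χ p.1 := by
    unfold partialDeriv
    rw [iteratedFDeriv_add_apply (hφ.contDiffAt.of_le (by exact_mod_cast le_top))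
      (hχ.contDiffAt.of_le (by exact_mod_cast le_top))]
    rfl
  unfold nuTerm
  rw [h, ← mul_add]
  gcongr
  exact norm_add_le _ _

lemma nuTerm_smul {n k : ℕ} {φ : EuclideanSpace ℝ (Fin n) → ℂ} (hφ : ContDiff ℝ ∞ φ) (c : ℂ)
    (p : NuIndex n k) : nuTerm k (c • φ) p = ‖c‖ * nuTerm k φ p := by
  have h : partialDeriv p.2.2 (c • φ) p.1 = c * partialDeriv p.2.2 φ p.1 := by
    unfold partialDeriv
    rw [iteratedFDeriv_const_smul_apply (hφ.contDiffAt.of_le (by exact_mod_cast le_top))]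
    rfl
  unfold nuTerm
  rw [h, norm_mul]
  ring

/-- The Hasumi-Silva space as a subspace of the space of all functions. -/
def kOneSubmodule (n : ℕ) : Submodule ℂ (EuclideanSpace ℝ (Fin n) → ℂ) where
  carrier := {φ | IsKOne φ}
  zero_mem' := by
    have h0 : ContDiff ℝ ∞ (0 : EuclideanSpace ℝ (Fin n) → ℂ) := contDiff_const
    refine ⟨h0, fun k => ⟨0, ?_⟩⟩
    rintro _ ⟨p, rfl⟩
    have h := nuTerm_smul h0 0 p
    simp only [zero_smul, norm_zero, zero_mul] at h
    exact h.le
  add_mem' := by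
    rintro φ χ ⟨hφ, hφ'⟩ ⟨hχ, hχ'⟩
    refine ⟨hφ.add hχ, fun k => ?_⟩
    obtain ⟨a, ha⟩ := hφ' k
    obtain ⟨b, hb⟩ := hχ' k
    refine ⟨a + b, ?_⟩
    rintro _ ⟨p, rfl⟩
    exact (nuTerm_add_le hφ hχ p).trans (add_le_add (ha ⟨p, rfl⟩) (hb ⟨p, rfl⟩))
  smul_mem' := by
    rintro c φ ⟨hφ, hφ'⟩
    refine ⟨hφ.const_smul c, fun k => ?_⟩
    obtain ⟨a, ha⟩ := hφ' k
    refine ⟨‖c‖ * a, ?_⟩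
    rintro _ ⟨p, rfl⟩
    rw [nuTerm_smul hφ]
    exact mul_le_mul_of_nonneg_left (ha ⟨p, rfl⟩) (norm_nonneg c)

/-- The Hasumi-Silva space `K₁(ℝⁿ)` of exponentially rapidly decreasing smooth functions. It is a
type of its own, so that it carries the topology given below and not that of pointwise
convergence. -/
def KOne (n : ℕ) : Type := ↥(kOneSubmodule n)

instance (n : ℕ) : AddCommGroup (KOne n) := inferInstanceAs (AddCommGroup ↥(kOneSubmodule n))

instance (n : ℕ) : Module ℂ (KOne n) := inferInstanceAs (Module ℂ ↥(kOneSubmodule n))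

instance (n : ℕ) : CoeFun (KOne n) (fun _ => EuclideanSpace ℝ (Fin n) → ℂ) := ⟨Subtype.val⟩

/-- The norm `ν_k(φ) = sup_{t, |α| ≤ k} e^{k|t|} |φ^(α)(t)|` on `K₁(ℝⁿ)`. -/
def nu (n k : ℕ) : Seminorm ℂ (KOne n) :=
  Seminorm.of (fun φ : KOne n => ⨆ p : NuIndex n k, nuTerm k φ p)
    (fun φ χ => by
      have : Nonempty (NuIndex n k) := ⟨(0, ⟨0, Fin.elim0⟩)⟩
      refine ciSup_le fun p => (nuTerm_add_le φ.2.1 χ.2.1 p).trans ?_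
      exact add_le_add (le_ciSup (φ.2.2 k) p) (le_ciSup (χ.2.2 k) p))
    (fun c φ => by
      rw [Real.mul_iSup_of_nonneg (norm_nonneg c)]
      exact congrArg iSup (funext fun p => nuTerm_smul φ.2.1 c p))

/-- The topology of `K₁(ℝⁿ)` is generated by the norms `ν_k`. -/
instance (n : ℕ) : TopologicalSpace (KOne n) :=
  (SeminormFamily.moduleFilterBasis (𝕜 := ℂ) (nu n)).topology

lemma withSeminorms_nu (n : ℕ) : WithSeminorms (𝕜 := ℂ) (nu n) := ⟨rfl⟩

instance (n : ℕ) : IsTopologicalAddGroup (KOne n) := (withSeminorms_nu n).topologicalAddGroup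

instance (n : ℕ) : ContinuousSMul ℂ (KOne n) := (withSeminorms_nu n).continuousSMul

/-- The space `K₁'(ℝⁿ)` of distributions of exponential type: the continuous linear functionals on
`K₁(ℝⁿ)`, with the strong dual topology (uniform convergence on bounded sets). -/
abbrev KOneDual (n : ℕ) : Type := StrongDual ℂ (KOne n)

lemma isKOne_of_iteratedFDeriv {n : ℕ} {φ : EuclideanSpace ℝ (Fin n) → ℂ} (hφ : ContDiff ℝ ∞ φ)
    (h : ∀ k m : ℕ, ∃ C : ℝ, ∀ t, Real.exp (k * ‖t‖) * ‖iteratedFDeriv ℝ m φ t‖ ≤ C) :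
    IsKOne φ := by
  refine ⟨hφ, fun k => ?_⟩
  choose C hC using h k
  refine ⟨∑ m : Fin (k + 1), |C m|, ?_⟩
  rintro _ ⟨⟨t, m, j⟩, rfl⟩
  have h1 : ‖partialDeriv j φ t‖ ≤ ‖iteratedFDeriv ℝ m φ t‖ := by
    refine (ContinuousMultilinearMap.le_opNorm _ _).trans ?_
    simp
  calc nuTerm k φ (t, ⟨m, j⟩) ≤ Real.exp (k * ‖t‖) * ‖iteratedFDeriv ℝ m φ t‖ := by
        unfold nuTerm; gcongr
    _ ≤ |C m| := (hC m t).trans (le_abs_self _)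
    _ ≤ ∑ m : Fin (k + 1), |C m| :=
        Finset.single_le_sum (f := fun m : Fin (k + 1) => |C m|)
          (fun i _ => abs_nonneg _) (Finset.mem_univ m)

lemma norm_iteratedFDeriv_le_sum {n : ℕ} (m : ℕ) (φ : EuclideanSpace ℝ (Fin n) → ℂ)
    (t : EuclideanSpace ℝ (Fin n)) :
    ‖iteratedFDeriv ℝ m φ t‖ ≤ ∑ j : Fin m → Fin n, ‖partialDeriv j φ t‖ := by
  refine ContinuousMultilinearMap.opNorm_le_bound (by positivity) fun v => ?_
  have hv : v = fun i => ∑ l : Fin n, v i l • EuclideanSpace.single l (1 : ℝ) := by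
    funext i
    ext a
    simp [Pi.single_apply]
  have h2 : iteratedFDeriv ℝ m φ t v
      = ∑ j : Fin m → Fin n, (∏ i, v i (j i)) • partialDeriv j φ t := by
    conv_lhs => rw [hv]
    rw [ContinuousMultilinearMap.map_sum]
    refine Finset.sum_congr rfl fun j _ => ?_
    rw [ContinuousMultilinearMap.map_smul_univ]
    rfl
  rw [h2, Finset.sum_mul]
  refine (norm_sum_le _ _).trans (Finset.sum_le_sum fun j _ => ?_)
  rw [norm_smul, mul_comm, norm_prod]
  gcongr with i
  exact PiLp.norm_apply_le (v i) (j i)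

lemma IsKOne.iteratedFDeriv_bound {n : ℕ} {φ : EuclideanSpace ℝ (Fin n) → ℂ} (hφ : IsKOne φ)
    (k m : ℕ) : ∃ C : ℝ, ∀ t, Real.exp (k * ‖t‖) * ‖iteratedFDeriv ℝ m φ t‖ ≤ C := by
  obtain ⟨A, hA⟩ := hφ.2 (max k m)
  refine ⟨∑ _j : Fin m → Fin n, A, fun t => ?_⟩
  refine (mul_le_mul_of_nonneg_left (norm_iteratedFDeriv_le_sum m φ t)
    (Real.exp_pos _).le).trans ?_
  rw [Finset.mul_sum]
  refine Finset.sum_le_sum fun j _ => ?_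
  refine le_trans ?_ (hA ⟨(t, ⟨⟨m, by omega⟩, j⟩), rfl⟩)
  unfold nuTerm
  gcongr
  exact le_max_left _ _

lemma norm_iteratedFDeriv_exp_le {n : ℕ} (L : EuclideanSpace ℝ (Fin n) →L[ℝ] ℂ) (m : ℕ)
    (t : EuclideanSpace ℝ (Fin n)) :
    ‖iteratedFDeriv ℝ m (fun s => Complex.exp (L s)) t‖ ≤ ‖L‖ ^ m * Real.exp (‖L‖ * ‖t‖) := by
  have hs : ContDiff ℝ ∞ (fun s => Complex.exp (L s)) := L.contDiff.cexp
  induction m with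
  | zero =>
    rw [norm_iteratedFDeriv_zero, pow_zero, one_mul, Complex.norm_exp]
    exact Real.exp_le_exp.2 (((le_abs_self _).trans (Complex.abs_re_le_norm _)).trans
      (L.le_opNorm t))
  | succ m ih =>
    have h2 : fderiv ℝ (fun s => Complex.exp (L s))
        = ((ContinuousLinearMap.lsmul ℝ ℂ :
            ℂ →L[ℝ] (EuclideanSpace ℝ (Fin n) →L[ℝ] ℂ) →L[ℝ] _).flip L) ∘
          fun s => Complex.exp (L s) := by
      funext s
      have := (L.hasFDerivAt (x := s)).cexp.fderiv
      simp [this]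
    have h3 : ‖(ContinuousLinearMap.lsmul ℝ ℂ :
            ℂ →L[ℝ] (EuclideanSpace ℝ (Fin n) →L[ℝ] ℂ) →L[ℝ] _).flip L‖ ≤ ‖L‖ := by
      refine ContinuousLinearMap.opNorm_le_bound _ (norm_nonneg L) fun c => ?_
      simp [norm_smul, mul_comm]
    rw [← norm_iteratedFDeriv_fderiv, h2]
    refine (ContinuousLinearMap.norm_iteratedFDeriv_comp_left _
      (hs.contDiffAt (x := t)) (n := m) (by exact_mod_cast le_top)).trans ?_
    rw [pow_succ', mul_assoc]
    exact mul_le_mul h3 ih (norm_nonneg _) (norm_nonneg _)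

/-- The function `t ↦ e^{-2πi z·t} conj (ψ (t - x))`, for `z ∈ ℂⁿ`. For real `z = ξ` it is the
complex conjugate of the time-frequency shift `M_ξ T_x ψ`. -/
def stftAtomFun {n : ℕ} (ψ : EuclideanSpace ℝ (Fin n) → ℂ) (x : EuclideanSpace ℝ (Fin n))
    (z : EuclideanSpace ℂ (Fin n)) (t : EuclideanSpace ℝ (Fin n)) : ℂ :=
  Complex.exp (-2 * Real.pi * Complex.I * ∑ j, z j * (t j : ℂ)) * starRingEnd ℂ (ψ (t - x))

lemma isKOne_stftAtomFun {n : ℕ} {ψ : EuclideanSpace ℝ (Fin n) → ℂ} (hψ : IsKOne ψ)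
    (x : EuclideanSpace ℝ (Fin n)) (z : EuclideanSpace ℂ (Fin n)) :
    IsKOne (stftAtomFun ψ x z) := by
  obtain ⟨L, hL⟩ : ∃ L : EuclideanSpace ℝ (Fin n) →L[ℝ] ℂ, ∀ t,
      L t = -2 * Real.pi * Complex.I * ∑ j, z j * (t j : ℂ) := by
    refine ⟨∑ j, (-2 * Real.pi * Complex.I * z j) •
      (Complex.ofRealCLM.comp (EuclideanSpace.proj j : EuclideanSpace ℝ (Fin n) →L[ℝ] ℝ)),
      fun t => ?_⟩
    simp [Finset.mul_sum, mul_assoc]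
  have hfun : stftAtomFun ψ x z = fun t => Complex.exp (L t) *
      (Complex.conjLIE ∘ fun s => ψ (s - x)) t := by
    funext t
    simp [stftAtomFun, hL]
  have hE : ContDiff ℝ ∞ (fun s => Complex.exp (L s)) := L.contDiff.cexp
  have hg : ContDiff ℝ ∞ (Complex.conjLIE ∘ fun s => ψ (s - x)) :=
    Complex.conjLIE.contDiff.comp (hψ.1.comp (contDiff_id.sub contDiff_const))
  rw [hfun]
  refine isKOne_of_iteratedFDeriv (hE.mul hg) fun k m => ?_
  obtain ⟨K, hK⟩ := exists_nat_ge ((k : ℝ) + ‖L‖)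
  choose C hC using hψ.iteratedFDeriv_bound K
  refine ⟨∑ i ∈ Finset.range (m + 1),
    (m.choose i : ℝ) * ‖L‖ ^ i * (Real.exp (K * ‖x‖) * C (m - i)), fun t => ?_⟩
  refine (mul_le_mul_of_nonneg_left (norm_iteratedFDeriv_mul_le hE hg t (n := m)
    (by exact_mod_cast le_top)) (Real.exp_pos _).le).trans ?_
  rw [Finset.mul_sum]
  refine Finset.sum_le_sum fun i _ => ?_
  rw [LinearIsometryEquiv.norm_iteratedFDeriv_comp_left, iteratedFDeriv_comp_sub]
  set D := ‖iteratedFDeriv ℝ (m - i) ψ (t - x)‖ with hD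
  have hexp : Real.exp (k * ‖t‖) * Real.exp (‖L‖ * ‖t‖)
      ≤ Real.exp (K * ‖x‖) * Real.exp (K * ‖t - x‖) := by
    rw [← Real.exp_add, ← Real.exp_add, Real.exp_le_exp, ← add_mul, ← mul_add]
    have ht : ‖t‖ ≤ ‖x‖ + ‖t - x‖ := by simpa using norm_add_le x (t - x)
    exact mul_le_mul hK ht (norm_nonneg _) (Nat.cast_nonneg K)
  calc Real.exp (k * ‖t‖) * ((m.choose i : ℝ) *
        ‖iteratedFDeriv ℝ i (fun s => Complex.exp (L s)) t‖ * D)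
      ≤ Real.exp (k * ‖t‖) * ((m.choose i : ℝ) * (‖L‖ ^ i * Real.exp (‖L‖ * ‖t‖)) * D) := by
        gcongr
        exact norm_iteratedFDeriv_exp_le L i t
    _ = (m.choose i : ℝ) * ‖L‖ ^ i *
        ((Real.exp (k * ‖t‖) * Real.exp (‖L‖ * ‖t‖)) * D) := by ring
    _ ≤ (m.choose i : ℝ) * ‖L‖ ^ i *
        ((Real.exp (K * ‖x‖) * Real.exp (K * ‖t - x‖)) * D) := by gcongr
    _ = (m.choose i : ℝ) * ‖L‖ ^ i *
        (Real.exp (K * ‖x‖) * (Real.exp (K * ‖t - x‖) * D)) := by ring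
    _ ≤ _ := by
        gcongr
        exact hC (m - i) (t - x)

/-- The function `t ↦ e^{-2πi z·t} conj (ψ (t - x))` as an element of `K₁(ℝⁿ)`. -/
def stftAtom {n : ℕ} (ψ : KOne n) (x : EuclideanSpace ℝ (Fin n))
    (z : EuclideanSpace ℂ (Fin n)) : KOne n :=
  ⟨stftAtomFun ψ x z, isKOne_stftAtomFun ψ.2 x z⟩

/-- The short-time Fourier transform `V_ψ f(x, z) = ⟨f(t), e^{-2πi z·t} conj (ψ (t - x))⟩` of
`f ∈ K₁'(ℝⁿ)` with window `ψ ∈ K₁(ℝⁿ)`, for `x ∈ ℝⁿ` and `z ∈ ℂⁿ`. -/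
def stft {n : ℕ} (ψ : KOne n) (f : KOneDual n) (x : EuclideanSpace ℝ (Fin n))
    (z : EuclideanSpace ℂ (Fin n)) : ℂ :=
  f (stftAtom ψ x z)

/-- The point `ξ + iη` of `ℂⁿ`. -/
def complexPoint {n : ℕ} (ξ η : EuclideanSpace ℝ (Fin n)) : EuclideanSpace ℂ (Fin n) :=
  WithLp.toLp 2 fun j => (ξ j : ℂ) + (η j : ℂ) * Complex.I

/-- The imaginary part of a point of `ℂⁿ`. -/
def imPart {n : ℕ} (z : EuclideanSpace ℂ (Fin n)) : EuclideanSpace ℝ (Fin n) :=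
  WithLp.toLp 2 fun j => (z j).im

/-- The tube `Π_r = ℝⁿ + i[-r, r]ⁿ`. -/
def tube (n : ℕ) (r : ℝ) : Set (EuclideanSpace ℂ (Fin n)) :=
  {z | ∀ j, (z j).im ∈ Set.Icc (-r) r}

end ExpType

end

/-!
Integrating `φ(t) |ψ(t - x)|²` over `x` gives `‖ψ‖₂² φ(t)`, and for fixed `x` Fourier inversion
writes `φ(t) |ψ(t - x)|²` as a superposition over `ξ` of the atoms defining `V_ψ f(x, ξ + iη)`, with
coefficients `𝓕⁻(e^{-2πη·t} φ(t) ψ(t - x))(ξ)`. Both integrals converge in every `ν_k`, so applying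
`f` gives `‖ψ‖₂² f(φ)` as an integral of these coefficients against `V_ψ f(x, ξ + iη)`. The
coefficients decay faster than any `e^{-k|x|} (1 + |ξ|)^{-k}`, with constants controlled by some
`ν_K(φ)`, so a bound on `V_ψ f` on `ℝⁿ × (ℝⁿ + iη)` gives `|f(φ)| ≤ C ν_K(φ)` uniformly in `f`.

Conversely, since `K₁(ℝⁿ)` is metrizable, a bounded set of functionals is dominated by a multiple of
a single `ν_k`, and `ν_k` of the atom at `(x, z)` grows at most like
`e^{k|x| + 2π x·Im z} (1 + |z|)^k` in a tube.
-/

noncomputable section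

namespace ExpType

open MeasureTheory Filter Topology
open scoped FourierTransform SchwartzMap

section SeminormFamily

variable {𝕜 E : Type*} [RCLike 𝕜] [AddCommGroup E] [Module 𝕜 E] [TopologicalSpace E]

lemma exists_le_mul_of_continuous_seminorm {ι : Type*} [Preorder ι] [IsDirectedOrder ι] [Nonempty ι]
    {p : SeminormFamily 𝕜 E ι} (hp : WithSeminorms p) (hmono : Monotone p) {q : Seminorm 𝕜 E}
    (hq : Continuous q) : ∃ (i : ι) (C : ℝ), 0 ≤ C ∧ ∀ x, q x ≤ C * p i x := by
  obtain ⟨s, C, -, hqs⟩ := Seminorm.bound_of_continuous hp q hq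
  obtain ⟨i, hi⟩ := s.exists_le
  refine ⟨i, C, C.2, fun x => (hqs x).trans ?_⟩
  exact mul_le_mul_of_nonneg_left
    (Seminorm.finset_sup_apply_le (apply_nonneg _ _) fun j hj => hmono (hi j hj) x) C.2

lemma continuous_of_norm_le_mul {ι G : Type*} [SeminormedAddCommGroup G] [NormedSpace 𝕜 G]
    {p : SeminormFamily 𝕜 E ι} (hp : WithSeminorms p) (T : E →ₗ[𝕜] G) (i : ι) {C : ℝ} (hC : 0 ≤ C)
    (hT : ∀ x, ‖T x‖ ≤ C * p i x) : Continuous T :=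
  hp.continuous_normedSpace_rng G T ⟨{i}, ⟨C, hC⟩, fun x => by
    rw [Finset.sup_singleton]
    exact hT x⟩

lemma isVonNBounded_range_of_apply_le_one {p : SeminormFamily 𝕜 E ℕ} (hp : WithSeminorms p)
    (hmono : Monotone p) {x : ℕ → E} (hx : ∀ j, p j (x j) ≤ 1) :
    Bornology.IsVonNBounded 𝕜 (Set.range x) := by
  rw [hp.isVonNBounded_iff_seminorm_bounded]
  intro k
  have hsum : 0 ≤ ∑ i ∈ Finset.range k, p k (x i) := Finset.sum_nonneg fun i _ => apply_nonneg _ _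
  refine ⟨∑ i ∈ Finset.range k, p k (x i) + 2, by linarith, ?_⟩
  rintro _ ⟨j, rfl⟩
  rcases lt_or_ge j k with hj | hj
  · have := Finset.single_le_sum (f := fun i => p k (x i)) (fun i _ => apply_nonneg _ _)
      (Finset.mem_range.2 hj)
    linarith
  · linarith [(hmono hj (x j)).trans (hx j)]

lemma isVonNBounded_of_norm_apply_le {ι : Type*} {p : SeminormFamily 𝕜 E ι} (hp : WithSeminorms p)
    {B : Set (StrongDual 𝕜 E)} {i : ι} {C : ℝ} (hB : ∀ f ∈ B, ∀ x, ‖f x‖ ≤ C * p i x) :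
    Bornology.IsVonNBounded 𝕜 B := by
  rw [ContinuousLinearMap.isVonNBounded_iff]
  intro s hs
  obtain ⟨r, -, hr⟩ := hp.isVonNBounded_iff_seminorm_bounded.1 hs i
  rw [NormedSpace.isVonNBounded_iff' 𝕜]
  refine ⟨|C| * r, ?_⟩
  rintro _ ⟨f, hf, x, hx, rfl⟩
  exact (hB f hf x).trans
    (mul_le_mul (le_abs_self C) (hr x hx).le (apply_nonneg _ _) (abs_nonneg C))

/- If `B` were not dominated by `j * p j` for any `j`, rescaling the witnesses `x j` would give a
bounded sequence on which members of `B` take arbitrarily large values. -/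
lemma exists_norm_apply_le_of_isVonNBounded {p : SeminormFamily 𝕜 E ℕ} (hp : WithSeminorms p)
    (hmono : Monotone p) {B : Set (StrongDual 𝕜 E)} (hB : Bornology.IsVonNBounded 𝕜 B) :
    ∃ (k : ℕ) (C : ℝ), 0 ≤ C ∧ ∀ f ∈ B, ∀ x, ‖f x‖ ≤ C * p k x := by
  by_contra! hcon
  choose f hf x hx using fun j : ℕ => hcon j j j.cast_nonneg
  have hpos (j : ℕ) : 0 < ‖f j (x j)‖ := (by positivity : 0 ≤ j * p j (x j)).trans_lt (hx j)
  let c : ℕ → 𝕜 := fun j => ((j / ‖f j (x j)‖ : ℝ) : 𝕜)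
  have hc (j : ℕ) : ‖c j‖ = j / ‖f j (x j)‖ := RCLike.norm_of_nonneg (by positivity)
  have hbdd : Bornology.IsVonNBounded 𝕜 (Set.range fun j => c j • x j) := by
    refine isVonNBounded_range_of_apply_le_one hp hmono fun j => ?_
    rw [map_smul_eq_mul, hc, div_mul_eq_mul_div, div_le_one (hpos j)]
    exact (hx j).le
  obtain ⟨M, hM⟩ := (NormedSpace.isVonNBounded_iff' 𝕜).1
    (ContinuousLinearMap.isVonNBounded_iff.1 hB _ hbdd)
  obtain ⟨j, hj⟩ := exists_nat_gt M
  have hfc : ‖f j (c j • x j)‖ = j := by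
    rw [map_smul, norm_smul, hc, div_mul_cancel₀ _ (hpos j).ne']
  linarith [hM _ ⟨f j, hf j, _, ⟨j, rfl⟩, rfl⟩]

end SeminormFamily

lemma exists_strongDual_comp_eq_of_norm_le {𝕜 V E : Type*} [RCLike 𝕜] [AddCommGroup V] [Module 𝕜 V]
    [SeminormedAddCommGroup E] [NormedSpace 𝕜 E] (T : V →ₗ[𝕜] E) (f : V →ₗ[𝕜] 𝕜) {C : ℝ}
    (hf : ∀ v, ‖f v‖ ≤ C * ‖T v‖) : ∃ F : StrongDual 𝕜 E, ∀ v, F (T v) = f v := by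
  obtain ⟨s, hs⟩ := T.rangeRestrict.exists_rightInverse_of_surjective T.range_rangeRestrict
  have hTs (y : T.range) : T (s y) = y := congrArg Subtype.val (LinearMap.congr_fun hs y)
  obtain ⟨F, hF, -⟩ := exists_extension_norm_eq T.range
    ((f ∘ₗ s).mkContinuous C fun y => (hf (s y)).trans_eq (by rw [hTs]; rfl))
  refine ⟨F, fun v => (hF (T.rangeRestrict v)).trans (sub_eq_zero.1 ?_)⟩
  change f (s (T.rangeRestrict v)) - f v = 0
  rw [← map_sub, ← norm_le_zero_iff]
  refine (hf _).trans_eq ?_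
  rw [map_sub, hTs, LinearMap.rangeRestrict, LinearMap.codRestrict_apply, sub_self, norm_zero,
    mul_zero]

section IteratedFDeriv

variable {E G : Type*} [NormedAddCommGroup E] [NormedSpace ℝ E] [NormedAddCommGroup G]
  [NormedSpace ℝ G]

lemma norm_iteratedFDeriv_mul_le_add_pow {A : Type*} [NormedRing A] [NormedAlgebra ℝ A]
    {f g : E → A} {m : ℕ} (hf : ContDiff ℝ m f) (hg : ContDiff ℝ m g) {t : E} {a b M N : ℝ}
    (hfM : ∀ i ≤ m, ‖iteratedFDeriv ℝ i f t‖ ≤ a ^ i * M)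
    (hgN : ∀ i ≤ m, ‖iteratedFDeriv ℝ i g t‖ ≤ b ^ i * N) :
    ‖iteratedFDeriv ℝ m (fun s => f s * g s) t‖ ≤ (a + b) ^ m * (M * N) := by
  refine (norm_iteratedFDeriv_mul_le hf hg t le_rfl).trans ?_
  rw [add_pow, Finset.sum_mul]
  refine Finset.sum_le_sum fun i hi => ?_
  have him : i ≤ m := Nat.lt_succ_iff.1 (Finset.mem_range.1 hi)
  have hfg := mul_le_mul (hfM i him) (hgN (m - i) (m.sub_le i)) (norm_nonneg _)
    ((norm_nonneg _).trans (hfM i him))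
  calc _ = m.choose i * (‖iteratedFDeriv ℝ i f t‖ * ‖iteratedFDeriv ℝ (m - i) g t‖) := by ring
    _ ≤ m.choose i * (a ^ i * M * (b ^ (m - i) * N)) := by gcongr
    _ = _ := by ring

lemma norm_iteratedFDeriv_cexp_comp_le (L : E →L[ℝ] ℂ) (m : ℕ) (t : E) :
    ‖iteratedFDeriv ℝ m (fun s => Complex.exp (L s)) t‖ ≤ ‖L‖ ^ m * Real.exp (L t).re := by
  have hexp : ‖iteratedFDeriv ℝ m Complex.exp (L t)‖ = Real.exp (L t).re := by
    rw [← (Complex.contDiff_exp (𝕜 := ℂ)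
        (n := m)).contDiffAt.restrictScalars_iteratedFDeriv (𝕜 := ℝ),
      Function.comp_apply, ContinuousMultilinearMap.norm_restrictScalars,
      norm_iteratedFDeriv_eq_norm_iteratedDeriv, iteratedDeriv_eq_iterate, Complex.iter_deriv_exp,
      Complex.norm_exp]
  have hcomp := L.iteratedFDeriv_comp_right (Complex.contDiff_exp (𝕜 := ℝ) (n := m)) t le_rfl
  calc _ ≤ ‖iteratedFDeriv ℝ m Complex.exp (L t)‖ * ∏ _i : Fin m, ‖L‖ := by
        rw [show (fun s => Complex.exp (L s)) = Complex.exp ∘ L from rfl, hcomp]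
        exact ContinuousMultilinearMap.norm_compContinuousLinearMap_le _ _
    _ = ‖L‖ ^ m * Real.exp (L t).re := by
        rw [hexp, Finset.prod_const, Finset.card_univ, Fintype.card_fin, mul_comm]

lemma contDiff_uncurry_iteratedFDeriv {P : Type*} [NormedAddCommGroup P] [NormedSpace ℝ P]
    {a : P → E → G} (ha : ContDiff ℝ ∞ (Function.uncurry a)) (m : ℕ) :
    ContDiff ℝ ∞ (Function.uncurry fun p => iteratedFDeriv ℝ m (a p)) := by
  induction m with
  | zero => exact (continuousMultilinearCurryFin0 ℝ E G).symm.contDiff.comp ha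
  | succ m ih =>
    have hfderiv : ContDiff ℝ ∞ fun q : P × E => fderiv ℝ (iteratedFDeriv ℝ m (a q.1)) q.2 :=
      ContDiff.fderiv (f := fun q : P × E => iteratedFDeriv ℝ m (a q.1))
        (ih.comp ((contDiff_fst.comp contDiff_fst).prodMk contDiff_snd)) contDiff_snd (by simp)
    exact (continuousMultilinearCurryLeftEquiv ℝ
      (fun _ : Fin (m + 1) => E) G).symm.contDiff.comp hfderiv

lemma iteratedFDeriv_integral {P : Type*} [MeasurableSpace P] {μ : Measure P} {F : P → E → G}
    {bound : ℕ → P → ℝ} (hF : ∀ p, ContDiff ℝ ∞ (F p))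
    (hmeas : ∀ m t, AEStronglyMeasurable (fun p => iteratedFDeriv ℝ m (F p) t) μ)
    (hbound : ∀ m p t, ‖iteratedFDeriv ℝ m (F p) t‖ ≤ bound m p)
    (hint : ∀ m, Integrable (bound m) μ) (m : ℕ) (t : E) :
    iteratedFDeriv ℝ m (fun s => ∫ p, F p s ∂μ) t = ∫ p, iteratedFDeriv ℝ m (F p) t ∂μ := by
  induction m generalizing t with
  | zero =>
    simp only [iteratedFDeriv_zero_eq_comp, Function.comp_apply]
    exact ((continuousMultilinearCurryFin0 ℝ E G).symm.toContinuousLinearEquiv.integral_comp_comm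
      fun p => F p t).symm
  | succ m ih =>
    let I := continuousMultilinearCurryLeftEquiv ℝ (fun _ : Fin (m + 1) => E) G
    have hI (f : E → G) (s : E) :
        iteratedFDeriv ℝ (m + 1) f s = I.symm (fderiv ℝ (iteratedFDeriv ℝ m f) s) := rfl
    have hfderiv : HasFDerivAt (fun s => ∫ p, iteratedFDeriv ℝ m (F p) s ∂μ)
        (∫ p, fderiv ℝ (iteratedFDeriv ℝ m (F p)) t ∂μ) t := by
      refine hasFDerivAt_integral_of_dominated_of_fderiv_le (𝕜 := ℝ) (bound := bound (m + 1))
        (F' := fun s p => fderiv ℝ (iteratedFDeriv ℝ m (F p)) s) univ_mem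
        (Eventually.of_forall (hmeas m))
        ((hint m).mono' (hmeas m t) (ae_of_all _ fun p => hbound m p t)) ?_
        (ae_of_all _ fun p s _ => ?_) (hint (m + 1)) (ae_of_all _ fun p s _ => ?_)
      · exact I.continuous.comp_aestronglyMeasurable (hmeas (m + 1) t)
      · rw [norm_fderiv_iteratedFDeriv]
        exact hbound (m + 1) p s
      · exact ((hF p).differentiable_iteratedFDeriv (by exact_mod_cast ENat.natCast_lt_top m)
          s).hasFDerivAt
    simp only [hI]
    rw [funext ih, hfderiv.fderiv]
    exact (ContinuousLinearEquiv.integral_comp_comm (𝕜 := ℝ) (E := E →L[ℝ] E [×m]→L[ℝ] G)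
      (F := E [×m + 1]→L[ℝ] G) (μ := μ) I.symm.toContinuousLinearEquiv
      fun p => fderiv ℝ (iteratedFDeriv ℝ m (F p)) t).symm

end IteratedFDeriv

section Integrals

variable {E : Type*} [NormedAddCommGroup E] [NormedSpace ℝ E] [FiniteDimensional ℝ E]
  [MeasurableSpace E] [BorelSpace E] {μ : Measure E} [μ.IsAddHaarMeasure]

lemma integrable_one_add_norm_pow_inv {m : ℕ} (hm : Module.finrank ℝ E < m) :
    Integrable (fun x : E => ((1 + ‖x‖) ^ m)⁻¹) μ := by
  refine (integrable_one_add_norm (μ := μ) (Nat.cast_lt.2 hm)).congr (ae_of_all _ fun x => ?_)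
  simp only [Real.rpow_neg (by positivity : 0 ≤ 1 + ‖x‖), Real.rpow_natCast]

lemma integrable_exp_neg_mul_norm {c : ℝ} (hc : 0 < c) :
    Integrable (fun x : E => Real.exp (-(c * ‖x‖))) μ := by
  let N := Module.finrank ℝ E + 1
  have hN : 0 < c / N := by positivity
  refine ((integrable_one_add_norm_pow_inv (μ := μ) (Nat.lt_succ_self _)).comp_smul hN.ne').mono'
    (by fun_prop) (ae_of_all _ fun x => ?_)
  rw [Real.norm_eq_abs, Real.abs_exp, norm_smul, Real.norm_of_nonneg hN.le, Real.exp_neg]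
  gcongr
  calc (1 + c / N * ‖x‖) ^ N ≤ Real.exp (c / N * ‖x‖) ^ N := by
        gcongr
        linarith [Real.add_one_le_exp (c / N * ‖x‖)]
    _ = Real.exp (c * ‖x‖) := by
        rw [← Real.exp_nat_mul, ← mul_assoc, mul_div_cancel₀ c (by positivity)]

end Integrals

lemma norm_integral_integral_le_of_norm_le_mul {X Y G : Type*} [MeasurableSpace X]
    [MeasurableSpace Y] {μ : Measure X} {ν : Measure Y} [NormedAddCommGroup G] [NormedSpace ℝ G]
    {F : X → Y → G} {g : X → ℝ} {h : Y → ℝ} (hg : Integrable g μ) (hh : Integrable h ν)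
    (hF : ∀ x y, ‖F x y‖ ≤ g x * h y) :
    ‖∫ x, ∫ y, F x y ∂ν ∂μ‖ ≤ (∫ x, g x ∂μ) * ∫ y, h y ∂ν := by
  rw [← integral_mul_const]
  refine norm_integral_le_of_norm_le (hg.mul_const _) (ae_of_all _ fun x => ?_)
  rw [← integral_const_mul]
  exact norm_integral_le_of_norm_le (hh.const_mul _) (ae_of_all _ fun y => hF x y)

variable {n : ℕ}

lemma nuTerm_le_nu {k : ℕ} (φ : KOne n) (p : NuIndex n k) : nuTerm k φ p ≤ nu n k φ :=
  le_ciSup (φ.2.2 k) p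

lemma nu_le_of_nuTerm_le {k : ℕ} {φ : KOne n} {C : ℝ} (h : ∀ p, nuTerm k φ p ≤ C) :
    nu n k φ ≤ C :=
  have : Nonempty (NuIndex n k) := ⟨(0, ⟨0, Fin.elim0⟩)⟩
  ciSup_le h

lemma monotone_nu : Monotone (nu n) := fun k l hkl φ => by
  refine nu_le_of_nuTerm_le fun p => le_trans ?_
    (nuTerm_le_nu φ (k := l) (p.1, ⟨⟨p.2.1, by omega⟩, p.2.2⟩))
  unfold nuTerm
  gcongr

lemma norm_partialDeriv_le {m : ℕ} (j : Fin m → Fin n) (φ : EuclideanSpace ℝ (Fin n) → ℂ)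
    (t : EuclideanSpace ℝ (Fin n)) : ‖partialDeriv j φ t‖ ≤ ‖iteratedFDeriv ℝ m φ t‖ :=
  (ContinuousMultilinearMap.le_opNorm _ _).trans_eq (by simp)

lemma nuTerm_le_of_norm_iteratedFDeriv_le {k : ℕ} {φ : EuclideanSpace ℝ (Fin n) → ℂ} {C : ℝ}
    (h : ∀ m ≤ k, ∀ t, ‖iteratedFDeriv ℝ m φ t‖ ≤ C * Real.exp (-(k * ‖t‖))) (p : NuIndex n k) :
    nuTerm k φ p ≤ C := by
  rw [nuTerm, mul_comm, ← le_div_iff₀ (Real.exp_pos _), div_eq_mul_inv, ← Real.exp_neg]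
  exact (norm_partialDeriv_le _ _ _).trans (h p.2.1 (by omega) p.1)

lemma isKOne_of_norm_iteratedFDeriv_le {φ : EuclideanSpace ℝ (Fin n) → ℂ} (hφ : ContDiff ℝ ∞ φ)
    (h : ∀ k : ℕ, ∃ C, ∀ m ≤ k, ∀ t, ‖iteratedFDeriv ℝ m φ t‖ ≤ C * Real.exp (-(k * ‖t‖))) :
    IsKOne φ := by
  refine ⟨hφ, fun k => ?_⟩
  obtain ⟨C, hC⟩ := h k
  exact ⟨C, Set.forall_mem_range.2 (nuTerm_le_of_norm_iteratedFDeriv_le hC)⟩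

lemma norm_iteratedFDeriv_le_nu {m k : ℕ} (hm : m ≤ k) (φ : KOne n)
    (t : EuclideanSpace ℝ (Fin n)) :
    ‖iteratedFDeriv ℝ m φ t‖ ≤ (n + 1) ^ m * (nu n k φ * Real.exp (-(k * ‖t‖))) := by
  have hpartial (j : Fin m → Fin n) :
      ‖partialDeriv j φ t‖ ≤ nu n k φ * Real.exp (-(k * ‖t‖)) := by
    rw [Real.exp_neg, ← div_eq_mul_inv, le_div_iff₀ (Real.exp_pos _), mul_comm]
    exact nuTerm_le_nu φ (k := k) (t, ⟨⟨m, by omega⟩, j⟩)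
  calc _ ≤ ∑ j : Fin m → Fin n, ‖partialDeriv j φ t‖ := norm_iteratedFDeriv_le_sum m φ t
    _ ≤ ∑ _j : Fin m → Fin n, nu n k φ * Real.exp (-(k * ‖t‖)) :=
        Finset.sum_le_sum fun j _ => hpartial j
    _ = (n : ℝ) ^ m * (nu n k φ * Real.exp (-(k * ‖t‖))) := by simp
    _ ≤ _ := by gcongr; linarith

lemma norm_iteratedFDeriv_le_mul_nu (m : ℕ) (φ : KOne n) (t : EuclideanSpace ℝ (Fin n)) :
    ‖iteratedFDeriv ℝ m φ t‖ ≤ (n + 1) ^ m * nu n m φ := by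
  refine (norm_iteratedFDeriv_le_nu le_rfl φ t).trans ?_
  gcongr
  exact mul_le_of_le_one_right (apply_nonneg _ _)
    (Real.exp_le_one_iff.2 (neg_nonpos.2 (by positivity)))

section Conj

lemma partialDeriv_conj {m : ℕ} (j : Fin m → Fin n) (φ : EuclideanSpace ℝ (Fin n) → ℂ)
    (t : EuclideanSpace ℝ (Fin n)) :
    partialDeriv j (fun s => starRingEnd ℂ (φ s)) t = starRingEnd ℂ (partialDeriv j φ t) := by
  unfold partialDeriv
  rw [show (fun s => starRingEnd ℂ (φ s)) = Complex.conjCLE ∘ φ from rfl,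
    ContinuousLinearEquiv.iteratedFDeriv_comp_left]
  rfl

lemma nuTerm_conj {k : ℕ} (φ : EuclideanSpace ℝ (Fin n) → ℂ) (p : NuIndex n k) :
    nuTerm k (fun s => starRingEnd ℂ (φ s)) p = nuTerm k φ p := by
  rw [nuTerm, partialDeriv_conj, RCLike.norm_conj, nuTerm]

/-- The complex conjugate of `φ`, as an element of `K₁(ℝⁿ)`. -/
def conj (φ : KOne n) : KOne n :=
  ⟨fun t => starRingEnd ℂ (φ t), Complex.conjCLE.contDiff.comp φ.2.1, fun k => by
    simpa only [funext (nuTerm_conj φ)] using φ.2.2 k⟩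

lemma conj_apply (φ : KOne n) (t : EuclideanSpace ℝ (Fin n)) :
    conj φ t = starRingEnd ℂ (φ t) := rfl

lemma nu_conj (k : ℕ) (φ : KOne n) : nu n k (conj φ) = nu n k φ :=
  congrArg iSup (funext (nuTerm_conj φ))

end Conj

section Translate

lemma nuTerm_comp_sub_le (k : ℕ) (φ : KOne n) (x : EuclideanSpace ℝ (Fin n)) (p : NuIndex n k) :
    nuTerm k (fun t => φ (t - x)) p ≤ Real.exp (k * ‖x‖) * nu n k φ := by
  have hp : partialDeriv p.2.2 (fun t => φ (t - x)) p.1 = partialDeriv p.2.2 φ (p.1 - x) := by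
    rw [partialDeriv, iteratedFDeriv_comp_sub, partialDeriv]
  have hexp : Real.exp (k * ‖p.1‖) ≤ Real.exp (k * ‖x‖) * Real.exp (k * ‖p.1 - x‖) := by
    rw [← Real.exp_add, ← mul_add, Real.exp_le_exp]
    gcongr
    exact norm_le_norm_add_norm_sub' _ _
  calc nuTerm k (fun t => φ (t - x)) p
      ≤ Real.exp (k * ‖x‖) * Real.exp (k * ‖p.1 - x‖) * ‖partialDeriv p.2.2 φ (p.1 - x)‖ := by
        rw [nuTerm, hp]
        gcongr
    _ ≤ _ := by
        rw [mul_assoc]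
        gcongr
        exact nuTerm_le_nu φ (p.1 - x, p.2)

/-- The translate `t ↦ φ (t - x)`, as an element of `K₁(ℝⁿ)`. -/
def translate (x : EuclideanSpace ℝ (Fin n)) (φ : KOne n) : KOne n :=
  ⟨fun t => φ (t - x), φ.2.1.comp (contDiff_id.sub contDiff_const), fun k =>
    ⟨_, Set.forall_mem_range.2 (nuTerm_comp_sub_le k φ x)⟩⟩

lemma translate_apply (x : EuclideanSpace ℝ (Fin n)) (φ : KOne n) (t : EuclideanSpace ℝ (Fin n)) :
    translate x φ t = φ (t - x) := rfl

lemma nu_translate_le (k : ℕ) (x : EuclideanSpace ℝ (Fin n)) (φ : KOne n) :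
    nu n k (translate x φ) ≤ Real.exp (k * ‖x‖) * nu n k φ :=
  nu_le_of_nuTerm_le (nuTerm_comp_sub_le k φ x)

end Translate

section Mul

lemma norm_iteratedFDeriv_mul_comp_sub_le (φ χ : KOne n) (x : EuclideanSpace ℝ (Fin n))
    {m k : ℕ} (hm : m ≤ k) (l : ℕ) (t : EuclideanSpace ℝ (Fin n)) :
    ‖iteratedFDeriv ℝ m (fun s => φ s * χ (s - x)) t‖ ≤
      (2 * (n + 1)) ^ k * (nu n (k + l) φ * nu n (k + l) χ) * Real.exp (-(l * ‖x‖)) *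
        Real.exp (-(k * ‖t‖)) := by
  have hφ (i : ℕ) (hi : i ≤ m) := norm_iteratedFDeriv_le_nu (hi.trans (hm.trans (k.le_add_right l)))
    φ t
  have hχ (i : ℕ) (hi : i ≤ m) :
      ‖iteratedFDeriv ℝ i (fun s => χ (s - x)) t‖ ≤
        (n + 1) ^ i * (nu n (k + l) χ * Real.exp (-((k + l : ℕ) * ‖t - x‖))) := by
    rw [iteratedFDeriv_comp_sub]
    exact norm_iteratedFDeriv_le_nu (hi.trans (hm.trans (k.le_add_right l))) χ (t - x)
  have hexp : Real.exp (-((k + l : ℕ) * ‖t‖)) * Real.exp (-((k + l : ℕ) * ‖t - x‖)) ≤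
      Real.exp (-(l * ‖x‖)) * Real.exp (-(k * ‖t‖)) := by
    rw [← Real.exp_add, ← Real.exp_add, Real.exp_le_exp]
    have hx : (l : ℝ) * ‖x‖ ≤ l * (‖t‖ + ‖t - x‖) := by
      gcongr
      exact norm_le_norm_add_norm_sub _ _
    have hk : (0 : ℝ) ≤ k * ‖t - x‖ := by positivity
    push_cast
    linarith
  have hpow : ((n : ℝ) + 1 + (n + 1)) ^ m ≤ (2 * (n + 1)) ^ k := by
    rw [← two_mul]
    exact pow_le_pow_right₀ (by linarith [n.cast_nonneg (α := ℝ)]) hm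
  refine (norm_iteratedFDeriv_mul_le_add_pow (φ.2.1.of_le (by exact_mod_cast le_top))
    ((translate x χ).2.1.of_le (by exact_mod_cast le_top)) hφ hχ).trans ?_
  calc _ = ((n : ℝ) + 1 + (n + 1)) ^ m * (nu n (k + l) φ * nu n (k + l) χ) *
        (Real.exp (-((k + l : ℕ) * ‖t‖)) * Real.exp (-((k + l : ℕ) * ‖t - x‖))) := by ring
    _ ≤ (2 * (n + 1)) ^ k * (nu n (k + l) φ * nu n (k + l) χ) *
        (Real.exp (-(l * ‖x‖)) * Real.exp (-(k * ‖t‖))) := by gcongr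
    _ = _ := by ring

/-- The pointwise product on `K₁(ℝⁿ)`. -/
instance : Mul (KOne n) :=
  ⟨fun φ χ => ⟨fun t => φ t * χ t, isKOne_of_norm_iteratedFDeriv_le (φ.2.1.mul χ.2.1) fun k =>
    ⟨_, fun m hm t => by
      simpa only [sub_zero] using norm_iteratedFDeriv_mul_comp_sub_le φ χ 0 hm 0 t⟩⟩⟩

lemma mul_apply (φ χ : KOne n) (t : EuclideanSpace ℝ (Fin n)) : (φ * χ) t = φ t * χ t := rfl

lemma nu_mul_translate_le (φ χ : KOne n) (x : EuclideanSpace ℝ (Fin n)) (k l : ℕ) :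
    nu n k (φ * translate x χ) ≤
      (2 * (n + 1)) ^ k * (nu n (k + l) φ * nu n (k + l) χ) * Real.exp (-(l * ‖x‖)) :=
  nu_le_of_nuTerm_le (nuTerm_le_of_norm_iteratedFDeriv_le fun _ hm t =>
    norm_iteratedFDeriv_mul_comp_sub_le φ χ x hm l t)

end Mul

section ExpMul

lemma norm_iteratedFDeriv_cexp_mul_le (L : EuclideanSpace ℝ (Fin n) →L[ℝ] ℂ) (φ : KOne n)
    {m k K : ℕ} (hm : m ≤ k) (hkK : k ≤ K) (hL : ∀ t, k * ‖t‖ + (L t).re ≤ K * ‖t‖)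
    (t : EuclideanSpace ℝ (Fin n)) :
    ‖iteratedFDeriv ℝ m (fun s => Complex.exp (L s) * φ s) t‖ ≤
      (‖L‖ + (n + 1)) ^ k * nu n K φ * Real.exp (-(k * ‖t‖)) := by
  have hexp : Real.exp (L t).re * Real.exp (-(K * ‖t‖)) ≤ Real.exp (-(k * ‖t‖)) := by
    rw [← Real.exp_add, Real.exp_le_exp]
    linarith [hL t]
  have hpow : (‖L‖ + (n + 1)) ^ m ≤ (‖L‖ + (n + 1)) ^ k :=
    pow_le_pow_right₀ (by linarith [norm_nonneg L, n.cast_nonneg (α := ℝ)]) hm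
  refine (norm_iteratedFDeriv_mul_le_add_pow L.contDiff.cexp
    (φ.2.1.of_le (by exact_mod_cast le_top))
    (fun i _ => norm_iteratedFDeriv_cexp_comp_le L i t)
    fun i hi => norm_iteratedFDeriv_le_nu (hi.trans (hm.trans hkK)) φ t).trans ?_
  calc _ = (‖L‖ + (n + 1)) ^ m * nu n K φ * (Real.exp (L t).re * Real.exp (-(K * ‖t‖))) := by ring
    _ ≤ _ := by gcongr

lemma exists_nat_mul_add_re_le (L : EuclideanSpace ℝ (Fin n) →L[ℝ] ℂ) (k : ℕ) :
    ∃ K, k ≤ K ∧ ∀ t, k * ‖t‖ + (L t).re ≤ K * ‖t‖ := by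
  obtain ⟨l, hl⟩ := exists_nat_ge ‖L‖
  refine ⟨k + l, k.le_add_right l, fun t => ?_⟩
  have hLt : (L t).re ≤ l * ‖t‖ :=
    (Complex.re_le_norm _).trans ((L.le_opNorm t).trans (by gcongr))
  push_cast
  linarith

/-- The product `t ↦ e^{L t} φ(t)` of `φ` with the exponential of a real-linear form `L`, as an
element of `K₁(ℝⁿ)`. -/
def expMul (L : EuclideanSpace ℝ (Fin n) →L[ℝ] ℂ) (φ : KOne n) : KOne n :=
  ⟨fun t => Complex.exp (L t) * φ t,
    isKOne_of_norm_iteratedFDeriv_le (L.contDiff.cexp.mul φ.2.1) fun k => by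
      obtain ⟨K, hkK, hK⟩ := exists_nat_mul_add_re_le L k
      exact ⟨_, fun m hm t => norm_iteratedFDeriv_cexp_mul_le L φ hm hkK hK t⟩⟩

lemma expMul_apply (L : EuclideanSpace ℝ (Fin n) →L[ℝ] ℂ) (φ : KOne n)
    (t : EuclideanSpace ℝ (Fin n)) : expMul L φ t = Complex.exp (L t) * φ t := rfl

lemma nu_expMul_le (L : EuclideanSpace ℝ (Fin n) →L[ℝ] ℂ) (φ : KOne n) {k K : ℕ} (hkK : k ≤ K)
    (hL : ∀ t, k * ‖t‖ + (L t).re ≤ K * ‖t‖) :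
    nu n k (expMul L φ) ≤ (‖L‖ + (n + 1)) ^ k * nu n K φ :=
  nu_le_of_nuTerm_le (nuTerm_le_of_norm_iteratedFDeriv_le fun _ hm t =>
    norm_iteratedFDeriv_cexp_mul_le L φ hm hkK hL t)

end ExpMul

section StftAtom

/-- The linear form `t ↦ -2πi z·t` in the exponent of the atoms of the short-time Fourier
transform. -/
def phase (z : EuclideanSpace ℂ (Fin n)) : EuclideanSpace ℝ (Fin n) →L[ℝ] ℂ :=
  ∑ j, (-2 * Real.pi * Complex.I * z j) •
    (Complex.ofRealCLM.comp (EuclideanSpace.proj j : EuclideanSpace ℝ (Fin n) →L[ℝ] ℝ))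

lemma phase_apply (z : EuclideanSpace ℂ (Fin n)) (t : EuclideanSpace ℝ (Fin n)) :
    phase z t = -2 * Real.pi * Complex.I * ∑ j, z j * (t j : ℂ) := by
  simp [phase, Finset.mul_sum, mul_assoc]

lemma phase_re (z : EuclideanSpace ℂ (Fin n)) (t : EuclideanSpace ℝ (Fin n)) :
    (phase z t).re = 2 * Real.pi * inner ℝ t (imPart z) := by
  rw [phase_apply]
  simp [imPart, PiLp.inner_apply, Complex.mul_re]

lemma norm_phase_le (z : EuclideanSpace ℂ (Fin n)) : ‖phase z‖ ≤ 2 * Real.pi * ‖z‖ := by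
  refine ContinuousLinearMap.opNorm_le_bound _ (by positivity) fun t => ?_
  let w : EuclideanSpace ℂ (Fin n) := WithLp.toLp 2 fun j => (t j : ℂ)
  let z' : EuclideanSpace ℂ (Fin n) := WithLp.toLp 2 fun j => starRingEnd ℂ (z j)
  have hw : ‖w‖ = ‖t‖ := by simp [w, EuclideanSpace.norm_eq]
  have hz : ‖z'‖ = ‖z‖ := by simp [z', EuclideanSpace.norm_eq]
  have hinner : ∑ j, z j * (t j : ℂ) = inner ℂ z' w := by
    simp [PiLp.inner_apply, z', w, mul_comm]
  have hconst : ‖(-2 * Real.pi * Complex.I : ℂ)‖ = 2 * Real.pi := by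
    simp [abs_of_pos Real.pi_pos]
  rw [phase_apply, hinner, norm_mul, hconst, ← hw, ← hz, mul_assoc (2 * Real.pi)]
  gcongr
  exact norm_inner_le_norm _ _

lemma stftAtom_apply (ψ : KOne n) (x : EuclideanSpace ℝ (Fin n)) (z : EuclideanSpace ℂ (Fin n))
    (t : EuclideanSpace ℝ (Fin n)) :
    stftAtom ψ x z t = Complex.exp (phase z t) * starRingEnd ℂ (ψ (t - x)) := by
  rw [phase_apply]; rfl

lemma stftAtom_eq_smul_translate (ψ : KOne n) (x : EuclideanSpace ℝ (Fin n))
    (z : EuclideanSpace ℂ (Fin n)) :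
    stftAtom ψ x z =
      Complex.exp (phase z x) • translate x (expMul (phase z) (conj ψ)) := by
  refine Subtype.ext (funext fun t => ?_)
  change stftAtom ψ x z t = Complex.exp (phase z x) *
    (Complex.exp (phase z (t - x)) * starRingEnd ℂ (ψ (t - x)))
  rw [stftAtom_apply, ← mul_assoc, ← Complex.exp_add, ← map_add, add_sub_cancel]

lemma norm_imPart_le_of_mem_tube {r : ℝ} {z : EuclideanSpace ℂ (Fin n)} (hz : z ∈ tube n r) :
    ‖imPart z‖ ≤ √(n * r ^ 2) := by
  rw [EuclideanSpace.norm_eq]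
  refine Real.sqrt_le_sqrt ?_
  calc ∑ j, ‖imPart z j‖ ^ 2 ≤ ∑ _j : Fin n, r ^ 2 := by
        refine Finset.sum_le_sum fun j _ => ?_
        rw [Real.norm_eq_abs, sq_abs]
        exact sq_le_sq' (hz j).1 (hz j).2
    _ = n * r ^ 2 := by simp

lemma nu_stftAtom_le (ψ : KOne n) (x : EuclideanSpace ℝ (Fin n)) (z : EuclideanSpace ℂ (Fin n))
    {k K : ℕ} (hK : k + 2 * Real.pi * ‖imPart z‖ ≤ K) :
    nu n k (stftAtom ψ x z) ≤ (2 * Real.pi * ‖z‖ + (n + 1)) ^ k * nu n K ψ *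
      Real.exp (k * ‖x‖ + 2 * Real.pi * inner ℝ x (imPart z)) := by
  have hkK : k ≤ K := by
    exact_mod_cast (le_add_of_nonneg_right (by positivity)).trans hK
  have hphase (t : EuclideanSpace ℝ (Fin n)) : k * ‖t‖ + (phase z t).re ≤ K * ‖t‖ := by
    have hinner : 2 * Real.pi * inner ℝ t (imPart z) ≤ 2 * Real.pi * (‖t‖ * ‖imPart z‖) := by
      gcongr
      exact real_inner_le_norm _ _
    rw [phase_re]
    linarith [mul_le_mul_of_nonneg_right hK (norm_nonneg t)]
  rw [stftAtom_eq_smul_translate, map_smul_eq_mul, Complex.norm_exp, phase_re]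
  calc _ ≤ Real.exp (2 * Real.pi * inner ℝ x (imPart z)) * (Real.exp (k * ‖x‖) *
        ((‖phase z‖ + (n + 1)) ^ k * nu n K (conj ψ))) := by
        gcongr
        refine (nu_translate_le k x _).trans ?_
        gcongr
        exact nu_expMul_le (phase z) (conj ψ) hkK hphase
    _ ≤ Real.exp (2 * Real.pi * inner ℝ x (imPart z)) * (Real.exp (k * ‖x‖) *
        ((2 * Real.pi * ‖z‖ + (n + 1)) ^ k * nu n K ψ)) := by
        rw [nu_conj]
        gcongr
        exact norm_phase_le z
    _ = _ := by rw [Real.exp_add]; ring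

lemma exists_nu_stftAtom_le_of_mem_tube (ψ : KOne n) (k : ℕ) (r : ℝ) :
    ∃ C : ℝ, 0 ≤ C ∧ ∀ x, ∀ z ∈ tube n r, nu n k (stftAtom ψ x z) ≤
      C * ((1 + ‖z‖) ^ k * Real.exp (k * ‖x‖ + 2 * Real.pi * inner ℝ x (imPart z))) := by
  obtain ⟨K, hK⟩ := exists_nat_ge (k + 2 * Real.pi * √(n * r ^ 2))
  refine ⟨(2 * Real.pi + (n + 1)) ^ k * nu n K ψ, by positivity, fun x z hz => ?_⟩
  have himPart : k + 2 * Real.pi * ‖imPart z‖ ≤ K := by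
    refine le_trans ?_ hK
    gcongr
    exact norm_imPart_le_of_mem_tube hz
  have hpow : (2 * Real.pi * ‖z‖ + (n + 1)) ^ k ≤ ((2 * Real.pi + (n + 1)) * (1 + ‖z‖)) ^ k := by
    gcongr
    have hn : 0 ≤ ((n : ℝ) + 1) * ‖z‖ := by positivity
    linarith [Real.pi_pos]
  refine (nu_stftAtom_le ψ x z himPart).trans ?_
  calc _ ≤ ((2 * Real.pi + (n + 1)) * (1 + ‖z‖)) ^ k * nu n K ψ *
        Real.exp (k * ‖x‖ + 2 * Real.pi * inner ℝ x (imPart z)) := by gcongr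
    _ = _ := by rw [mul_pow]; ring

theorem stft_bound_of_isVonNBounded (ψ : KOne n) {B : Set (KOneDual n)}
    (hB : Bornology.IsVonNBounded ℂ B) :
    ∃ k : ℕ, ∀ r : ℝ, ∃ C : ℝ, ∀ f ∈ B, ∀ x : EuclideanSpace ℝ (Fin n), ∀ z ∈ tube n r,
      Real.exp (-(k * ‖x‖) - 2 * Real.pi * inner ℝ x (imPart z)) * ((1 + ‖z‖) ^ k)⁻¹ *
        ‖stft ψ f x z‖ ≤ C := by
  obtain ⟨k, C, hC, hB⟩ := exists_norm_apply_le_of_isVonNBounded (withSeminorms_nu n) monotone_nu hB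
  refine ⟨k, fun r => ?_⟩
  obtain ⟨A, -, hA⟩ := exists_nu_stftAtom_le_of_mem_tube ψ k r
  refine ⟨C * A, fun f hf x z hz => ?_⟩
  rw [← neg_add', Real.exp_neg, ← mul_inv, inv_mul_le_iff₀ (by positivity)]
  calc ‖stft ψ f x z‖ ≤ C * nu n k (stftAtom ψ x z) := hB f hf _
    _ ≤ C * (A * ((1 + ‖z‖) ^ k * Real.exp (k * ‖x‖ + 2 * Real.pi * inner ℝ x (imPart z)))) := by
        gcongr
        exact hA x z hz
    _ = _ := by ring

lemma imPart_complexPoint (ξ η : EuclideanSpace ℝ (Fin n)) : imPart (complexPoint ξ η) = η := by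
  ext j
  simp [imPart, complexPoint]

lemma phase_complexPoint (ξ η t : EuclideanSpace ℝ (Fin n)) :
    phase (complexPoint ξ η) t =
      ((-2 * Real.pi * inner ℝ t ξ : ℝ) : ℂ) * Complex.I + phase (complexPoint 0 η) t := by
  simp only [phase_apply, complexPoint, PiLp.inner_apply, RCLike.inner_apply, conj_trivial,
    PiLp.zero_apply, Complex.ofReal_zero, zero_add, add_mul, Finset.sum_add_distrib, mul_add]
  push_cast
  ring

lemma complexPoint_mem_tube (ξ η : EuclideanSpace ℝ (Fin n)) : complexPoint ξ η ∈ tube n ‖η‖ :=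
  fun j => by
    have hj : (complexPoint ξ η j).im = η j := congrArg (· j) (imPart_complexPoint ξ η)
    rw [hj]
    exact abs_le.1 (PiLp.norm_apply_le η j)

lemma norm_complexPoint_le (ξ η : EuclideanSpace ℝ (Fin n)) :
    ‖complexPoint ξ η‖ ≤ ‖ξ‖ + ‖η‖ := by
  have hsplit : complexPoint ξ η =
      (WithLp.toLp 2 fun j => (ξ j : ℂ) : EuclideanSpace ℂ (Fin n)) +
        Complex.I • (WithLp.toLp 2 fun j => (η j : ℂ) : EuclideanSpace ℂ (Fin n)) := by
    ext j
    simp [complexPoint, mul_comm]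
  rw [hsplit]
  refine (norm_add_le _ _).trans_eq ?_
  simp [norm_smul, EuclideanSpace.norm_eq]

lemma exists_nu_stftAtom_complexPoint_le (ψ : KOne n) (x η : EuclideanSpace ℝ (Fin n)) (k : ℕ) :
    ∃ C : ℝ, ∀ ξ, nu n k (stftAtom ψ x (complexPoint ξ η)) ≤ C * (1 + ‖ξ‖) ^ k := by
  obtain ⟨C, hC, hle⟩ := exists_nu_stftAtom_le_of_mem_tube ψ k ‖η‖
  refine ⟨C * ((1 + ‖η‖) ^ k * Real.exp (k * ‖x‖ + 2 * Real.pi * inner ℝ x η)), fun ξ => ?_⟩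
  have hpow : (1 + ‖complexPoint ξ η‖) ^ k ≤ ((1 + ‖η‖) * (1 + ‖ξ‖)) ^ k := by
    gcongr
    linarith [norm_complexPoint_le ξ η, mul_nonneg (norm_nonneg η) (norm_nonneg ξ)]
  refine (hle x _ (complexPoint_mem_tube ξ η)).trans ?_
  rw [imPart_complexPoint]
  calc _ ≤ C * (((1 + ‖η‖) * (1 + ‖ξ‖)) ^ k *
        Real.exp (k * ‖x‖ + 2 * Real.pi * inner ℝ x η)) := by gcongr
    _ = _ := by rw [mul_pow]; ring

end StftAtom

section Integral

/-- The iterated Fréchet derivative of order `m` at `t`, as a continuous linear map. -/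
def derivAt (m : ℕ) (t : EuclideanSpace ℝ (Fin n)) :
    KOne n →L[ℂ] EuclideanSpace ℝ (Fin n) [×m]→L[ℝ] ℂ :=
  let D : KOne n →ₗ[ℂ] EuclideanSpace ℝ (Fin n) [×m]→L[ℝ] ℂ :=
    { toFun := fun φ => iteratedFDeriv ℝ m φ t
      map_add' := fun φ χ => iteratedFDeriv_add_apply
        (φ.2.1.contDiffAt.of_le (by exact_mod_cast le_top))
        (χ.2.1.contDiffAt.of_le (by exact_mod_cast le_top))
      map_smul' := fun c φ => iteratedFDeriv_const_smul_apply
        (φ.2.1.contDiffAt.of_le (by exact_mod_cast le_top)) }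
  ⟨D, continuous_of_norm_le_mul (withSeminorms_nu n) D m (by positivity)
    fun φ => norm_iteratedFDeriv_le_mul_nu m φ t⟩

lemma derivAt_apply (m : ℕ) (t : EuclideanSpace ℝ (Fin n)) (φ : KOne n) :
    derivAt m t φ = iteratedFDeriv ℝ m φ t := rfl

lemma partialDeriv_eq_derivAt_apply {m : ℕ} (j : Fin m → Fin n) (φ : KOne n)
    (t : EuclideanSpace ℝ (Fin n)) :
    partialDeriv j φ t = derivAt m t φ fun i => EuclideanSpace.single (j i) (1 : ℝ) := rfl

/-- The embedding of `K₁(ℝⁿ)` into a Banach space of bounded functions that turns `ν_k` into the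
norm. -/
def toBounded (n k : ℕ) : KOne n →ₗ[ℂ] lp (fun _ : NuIndex n k => ℂ) ⊤ where
  toFun φ := ⟨fun p => (Real.exp (k * ‖p.1‖) : ℂ) * partialDeriv p.2.2 φ p.1,
    memℓp_infty ⟨nu n k φ, Set.forall_mem_range.2 fun p => by
      simpa [nuTerm, Complex.norm_exp] using nuTerm_le_nu φ p⟩⟩
  map_add' φ χ := by
    ext p
    simp [partialDeriv_eq_derivAt_apply, mul_add]
    rfl
  map_smul' c φ := by
    ext p
    simp [partialDeriv_eq_derivAt_apply, mul_left_comm]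

lemma toBounded_apply (k : ℕ) (φ : KOne n) (p : NuIndex n k) :
    toBounded n k φ p = (Real.exp (k * ‖p.1‖) : ℂ) * partialDeriv p.2.2 φ p.1 := rfl

lemma norm_toBounded (k : ℕ) (φ : KOne n) : ‖toBounded n k φ‖ = nu n k φ := by
  rw [lp.norm_eq_ciSup]
  refine congrArg iSup (funext fun p => ?_)
  rw [toBounded_apply, norm_mul, Complex.norm_real, Real.norm_eq_abs, Real.abs_exp]
  rfl

lemma continuous_toBounded (n k : ℕ) : Continuous (toBounded n k) :=
  continuous_of_norm_le_mul (withSeminorms_nu n) _ k zero_le_one fun φ => by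
    rw [norm_toBounded, one_mul]

variable {P : Type*} [TopologicalSpace P] [SecondCountableTopology P] [MeasurableSpace P]
  [OpensMeasurableSpace P] {μ : Measure P} {a : P → KOne n} {φ : KOne n}

lemma integrable_derivAt (ha : Continuous a) (hint : ∀ k, Integrable (fun p => nu n k (a p)) μ)
    (m : ℕ) (t : EuclideanSpace ℝ (Fin n)) : Integrable (fun p => derivAt m t (a p)) μ :=
  ((hint m).const_mul ((n + 1) ^ m)).mono'
    ((derivAt m t).continuous.comp ha).aestronglyMeasurable
    (ae_of_all _ fun p => norm_iteratedFDeriv_le_mul_nu m (a p) t)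

lemma integrable_toBounded (ha : Continuous a) {k : ℕ}
    (hint : Integrable (fun p => nu n k (a p)) μ) : Integrable (fun p => toBounded n k (a p)) μ :=
  hint.mono' ((continuous_toBounded n k).comp ha).aestronglyMeasurable
    (ae_of_all _ fun p => (norm_toBounded k (a p)).le)

lemma integral_derivAt (ha : Continuous a) (hint : ∀ k, Integrable (fun p => nu n k (a p)) μ)
    (hφ : ∀ t, ∫ p, a p t ∂μ = φ t) (m : ℕ) (t : EuclideanSpace ℝ (Fin n)) :
    ∫ p, derivAt m t (a p) ∂μ = derivAt m t φ := by
  have hF := iteratedFDeriv_integral (μ := μ) (F := fun p => ⇑(a p)) (fun p => (a p).2.1)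
    (fun m t => (integrable_derivAt ha hint m t).1)
    (fun m p t => norm_iteratedFDeriv_le_mul_nu m (a p) t)
    (fun m => (hint m).const_mul ((n + 1) ^ m)) m t
  rw [derivAt_apply, ← funext hφ, hF]
  rfl

lemma integral_toBounded (ha : Continuous a) (hint : ∀ k, Integrable (fun p => nu n k (a p)) μ)
    (hφ : ∀ t, ∫ p, a p t ∂μ = φ t) (k : ℕ) :
    ∫ p, toBounded n k (a p) ∂μ = toBounded n k φ := by
  ext q
  have heval := (lp.evalCLM ℂ (fun _ : NuIndex n k => ℂ) ⊤ q).integral_comp_comm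
    (integrable_toBounded ha (hint k))
  have hpartial := (ContinuousMultilinearMap.apply ℝ
    (fun _ : Fin (q.2.1 : ℕ) => EuclideanSpace ℝ (Fin n)) ℂ
    (fun i => EuclideanSpace.single (q.2.2 i) (1 : ℝ))).integral_comp_comm
    (integrable_derivAt ha hint q.2.1 q.1)
  rw [integral_derivAt ha hint hφ] at hpartial
  calc _ = ∫ p, (Real.exp (k * ‖q.1‖) : ℂ) * partialDeriv q.2.2 (a p) q.1 ∂μ := heval.symm
    _ = _ := by
      rw [integral_const_mul]
      exact congrArg _ hpartial

/- By Hahn-Banach, `f` factors through the Banach space in which the integral converges. -/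
theorem dual_apply_eq_integral (f : KOneDual n) (ha : Continuous a)
    (hint : ∀ k, Integrable (fun p => nu n k (a p)) μ) (hφ : ∀ t, ∫ p, a p t ∂μ = φ t) :
    f φ = ∫ p, f (a p) ∂μ := by
  obtain ⟨k, C, -, hf⟩ := exists_le_mul_of_continuous_seminorm (withSeminorms_nu n) monotone_nu
    (q := (normSeminorm ℂ ℂ).comp f.toLinearMap) f.continuous.norm
  obtain ⟨F, hF⟩ := exists_strongDual_comp_eq_of_norm_le (toBounded n k) f.toLinearMap
    fun χ => (hf χ).trans_eq (by rw [norm_toBounded])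
  calc f φ = F (∫ p, toBounded n k (a p) ∂μ) := by
        rw [integral_toBounded ha hint hφ, hF]; rfl
    _ = ∫ p, f (a p) ∂μ := by
        rw [← F.integral_comp_comm (integrable_toBounded ha (hint k))]
        exact integral_congr_ae (ae_of_all _ fun p => hF (a p))

end Integral

section Continuity

lemma nu_le_of_forall_closedBall {k : ℕ} {φ : KOne n} {R δ C : ℝ} (hφ : nu n (k + 1) φ ≤ C)
    (hball : ∀ m ≤ k, ∀ t ∈ Metric.closedBall (0 : EuclideanSpace ℝ (Fin n)) R,
      Real.exp (k * ‖t‖) * ‖iteratedFDeriv ℝ m φ t‖ ≤ δ)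
    (hR : C * Real.exp (-R) ≤ δ) : nu n k φ ≤ δ := by
  refine nu_le_of_nuTerm_le fun p => ?_
  rcases le_or_gt ‖p.1‖ R with hp | hp
  · refine le_trans ?_ (hball p.2.1 (by omega) p.1 (mem_closedBall_zero_iff.2 hp))
    rw [nuTerm]
    gcongr
    exact norm_partialDeriv_le _ _ _
  · have hterm : nuTerm (k + 1) φ (p.1, ⟨⟨p.2.1, by omega⟩, p.2.2⟩) =
        Real.exp ‖p.1‖ * nuTerm k φ p := by
      simp only [nuTerm, Nat.cast_succ, add_mul, one_mul, Real.exp_add]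
      ring
    have hexp : nuTerm k φ p ≤ C * Real.exp (-‖p.1‖) := by
      rw [Real.exp_neg, ← div_eq_mul_inv, le_div_iff₀' (Real.exp_pos _), ← hterm]
      exact (nuTerm_le_nu φ _).trans hφ
    refine hexp.trans (le_trans ?_ hR)
    have hC : 0 ≤ C := (apply_nonneg _ _).trans hφ
    gcongr

variable {P : Type*} [NormedAddCommGroup P] [NormedSpace ℝ P] {a : P → KOne n}

lemma eventually_forall_mem_norm_iteratedFDeriv_sub_le
    (ha : ContDiff ℝ ∞ (Function.uncurry fun p => ⇑(a p))) (k m : ℕ)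
    {s : Set (EuclideanSpace ℝ (Fin n))} (hs : IsCompact s) {δ : ℝ} (hδ : 0 < δ) (p₀ : P) :
    ∀ᶠ p in 𝓝 p₀, ∀ t ∈ s,
      Real.exp (k * ‖t‖) * ‖iteratedFDeriv ℝ m (a p - a p₀ : KOne n) t‖ ≤ δ := by
  have hcont : Continuous (Function.uncurry fun (p : P) (t : EuclideanSpace ℝ (Fin n)) =>
      Real.exp (k * ‖t‖) • iteratedFDeriv ℝ m (a p) t) :=
    Continuous.smul (f := fun q : P × EuclideanSpace ℝ (Fin n) => Real.exp (k * ‖q.2‖))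
      (by fun_prop) (contDiff_uncurry_iteratedFDeriv ha m).continuous
  obtain ⟨v, hv, hdist⟩ := hs.mem_uniformity_of_prod (s := Set.univ) hcont.continuousOn
    (Set.mem_univ p₀) (Metric.dist_mem_uniformity hδ)
  filter_upwards [nhdsWithin_univ p₀ ▸ hv] with p hp t ht
  have hlt : dist (Real.exp (k * ‖t‖) • iteratedFDeriv ℝ m (a p) t)
      (Real.exp (k * ‖t‖) • iteratedFDeriv ℝ m (a p₀) t) < δ := hdist p hp t ht
  rw [dist_eq_norm, ← smul_sub, norm_smul, Real.norm_eq_abs, Real.abs_exp, ← derivAt_apply,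
    ← derivAt_apply, ← map_sub] at hlt
  exact hlt.le

/- A uniform bound on `ν_{k + 1}` makes the contributions to `ν_k` from outside a large ball
small, and on the ball the derivatives converge uniformly by compactness. -/
lemma continuous_of_contDiff_of_nu_le (ha : ContDiff ℝ ∞ (Function.uncurry fun p => ⇑(a p)))
    (hbound : ∀ k p₀, ∃ C, ∀ᶠ p in 𝓝 p₀, nu n k (a p) ≤ C) : Continuous a := by
  refine continuous_iff_continuousAt.2 fun p₀ => ?_
  rw [ContinuousAt, (withSeminorms_nu n).tendsto_nhds]
  intro k ε hε
  obtain ⟨C, hC⟩ := hbound (k + 1) p₀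
  have hlim : Tendsto (fun R : ℝ => (C + C) * Real.exp (-R)) atTop (𝓝 0) := by
    simpa using Real.tendsto_exp_neg_atTop_nhds_zero.const_mul (C + C)
  obtain ⟨R, hR⟩ := (hlim.eventually (gt_mem_nhds (half_pos hε))).exists
  have hball := (eventually_all_finset (Finset.Iic k)).2 fun m _ =>
    eventually_forall_mem_norm_iteratedFDeriv_sub_le ha k m
      (isCompact_closedBall (0 : EuclideanSpace ℝ (Fin n)) R) (half_pos hε) p₀
  filter_upwards [hball, hC] with p hp hpC
  refine (nu_le_of_forall_closedBall ?_ (fun m hm => hp m (Finset.mem_Iic.2 hm)) hR.le).trans_lt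
    (half_lt_self hε)
  exact (map_sub_le_add _ _ _).trans (add_le_add hpC hC.self_of_nhds)

end Continuity

section Schwartz

lemma norm_pow_mul_norm_iteratedFDeriv_le (k m : ℕ) (φ : KOne n) (t : EuclideanSpace ℝ (Fin n)) :
    ‖t‖ ^ k * ‖iteratedFDeriv ℝ m φ t‖ ≤ (n + 1) ^ m * nu n (k + m) φ := by
  have hexp : ‖t‖ ^ k * Real.exp (-((k + m : ℕ) * ‖t‖)) ≤ 1 := by
    calc ‖t‖ ^ k * Real.exp (-((k + m : ℕ) * ‖t‖))
        ≤ Real.exp ‖t‖ ^ k * Real.exp (-(k * ‖t‖)) := by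
          gcongr
          · linarith [Real.add_one_le_exp ‖t‖]
          · exact k.le_add_right m
      _ = 1 := by rw [← Real.exp_nat_mul, ← Real.exp_add, add_neg_cancel, Real.exp_zero]
  calc ‖t‖ ^ k * ‖iteratedFDeriv ℝ m φ t‖
      ≤ ‖t‖ ^ k * ((n + 1) ^ m * (nu n (k + m) φ * Real.exp (-((k + m : ℕ) * ‖t‖)))) := by
        gcongr
        exact norm_iteratedFDeriv_le_nu (m.le_add_left k) φ t
    _ = (n + 1) ^ m * nu n (k + m) φ * (‖t‖ ^ k * Real.exp (-((k + m : ℕ) * ‖t‖))) := by ring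
    _ ≤ _ := mul_le_of_le_one_right (by positivity) hexp

/-- The inclusion of `K₁(ℝⁿ)` into the Schwartz space. -/
def toSchwartz : KOne n →L[ℂ] 𝓢(EuclideanSpace ℝ (Fin n), ℂ) :=
  let T : KOne n →ₗ[ℂ] 𝓢(EuclideanSpace ℝ (Fin n), ℂ) :=
    { toFun := fun φ => ⟨φ, φ.2.1, fun k m => ⟨_, norm_pow_mul_norm_iteratedFDeriv_le k m φ⟩⟩
      map_add' := fun _ _ => rfl
      map_smul' := fun _ _ => rfl }
  ⟨T, (withSeminorms_nu n).continuous_of_isBounded (schwartz_withSeminorms ℂ _ _) T fun i =>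
    ⟨{i.1 + i.2}, (n + 1) ^ i.2, fun φ => by
      rw [Finset.sup_singleton]
      exact SchwartzMap.seminorm_le_bound ℂ i.1 i.2 _ (by positivity)
        (norm_pow_mul_norm_iteratedFDeriv_le i.1 i.2 φ)⟩⟩

lemma toSchwartz_apply (φ : KOne n) (t : EuclideanSpace ℝ (Fin n)) : toSchwartz φ t = φ t := rfl

lemma integrable_coe (φ : KOne n) : Integrable φ := (toSchwartz φ).integrable

lemma exists_norm_fourierInv_toSchwartz_le (n k : ℕ) :
    ∃ (K : ℕ) (C : ℝ), 0 ≤ C ∧ ∀ (φ : KOne n) (ξ : EuclideanSpace ℝ (Fin n)),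
      ‖𝓕⁻ (toSchwartz φ) ξ‖ ≤ C * nu n K φ * ((1 + ‖ξ‖) ^ k)⁻¹ := by
  let q := (Finset.Iic (k, 0)).sup (schwartzSeminormFamily ℂ (EuclideanSpace ℝ (Fin n)) ℂ)
  let T := FourierTransform.fourierInvCLM ℂ 𝓢(EuclideanSpace ℝ (Fin n), ℂ) ∘L toSchwartz
  have hq : Continuous (q.comp T.toLinearMap) := by
    have hsup := (schwartz_withSeminorms ℂ
      (EuclideanSpace ℝ (Fin n)) ℂ).finset_sups.continuous_seminorm (Finset.Iic (k, 0))
    exact hsup.comp T.continuous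
  obtain ⟨K, C, hC, hle⟩ := exists_le_mul_of_continuous_seminorm (withSeminorms_nu n) monotone_nu hq
  refine ⟨K, 2 ^ k * C, by positivity, fun φ ξ => ?_⟩
  have hdecay := SchwartzMap.one_add_le_sup_seminorm_apply (𝕜 := ℂ) (m := (k, 0)) le_rfl le_rfl
    (𝓕⁻ (toSchwartz φ)) ξ
  rw [norm_iteratedFDeriv_zero] at hdecay
  rw [← div_eq_mul_inv, le_div_iff₀' (by positivity), mul_assoc]
  exact hdecay.trans (mul_le_mul_of_nonneg_left (hle φ) (by positivity))

lemma integral_cexp_mul_fourierInv_toSchwartz (φ : KOne n) (t : EuclideanSpace ℝ (Fin n)) :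
    ∫ ξ, Complex.exp ((-2 * Real.pi * inner ℝ t ξ : ℝ) * Complex.I) * 𝓕⁻ (toSchwartz φ) ξ =
      φ t := by
  have hinv : 𝓕 (𝓕⁻ (toSchwartz φ)) t = φ t := by
    rw [FourierTransform.fourier_fourierInv_eq, toSchwartz_apply]
  rw [← hinv, SchwartzMap.fourier_coe, Real.fourier_eq']
  simp only [real_inner_comm t, smul_eq_mul]

end Schwartz

section Reconstruction

lemma continuous_stftAtom (ψ : KOne n) (x η : EuclideanSpace ℝ (Fin n)) :
    Continuous fun ξ => stftAtom ψ x (complexPoint ξ η) := by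
  refine continuous_of_contDiff_of_nu_le ?_ fun k ξ₀ => ?_
  · have heq : (Function.uncurry fun ξ => ⇑(stftAtom ψ x (complexPoint ξ η))) =
        fun q : EuclideanSpace ℝ (Fin n) × EuclideanSpace ℝ (Fin n) =>
          Complex.exp (Complex.ofRealCLM (-2 * Real.pi * inner ℝ q.2 q.1) * Complex.I +
            phase (complexPoint 0 η) q.2) * conj ψ (q.2 - x) := by
      funext q
      rw [Function.uncurry, stftAtom_apply, phase_complexPoint]
      rfl
    rw [heq]
    have hinner : ContDiff ℝ ∞ fun q : EuclideanSpace ℝ (Fin n) × EuclideanSpace ℝ (Fin n) =>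
        Complex.ofRealCLM (-2 * Real.pi * inner ℝ q.2 q.1) :=
      Complex.ofRealCLM.contDiff.comp (contDiff_const.mul (contDiff_snd.inner ℝ contDiff_fst))
    exact ((hinner.mul contDiff_const).add
      ((phase (complexPoint 0 η)).contDiff.comp contDiff_snd)).cexp.mul
      ((conj ψ).2.1.comp (contDiff_snd.sub contDiff_const))
  · obtain ⟨C, hC⟩ := exists_nu_stftAtom_complexPoint_le ψ x η k
    have hcont : Continuous fun ξ : EuclideanSpace ℝ (Fin n) => C * (1 + ‖ξ‖) ^ k := by fun_prop
    exact ⟨_, ((hcont.tendsto ξ₀).eventually (gt_mem_nhds (lt_add_one _))).mono fun ξ hξ =>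
      (hC ξ).trans hξ.le⟩

lemma continuous_mul_translate (φ χ : KOne n) : Continuous fun x => φ * translate x χ :=
  continuous_of_contDiff_of_nu_le
    ((φ.2.1.comp contDiff_snd).mul (χ.2.1.comp (contDiff_snd.sub contDiff_fst)))
    fun k _ => ⟨_, Eventually.of_forall fun x => by
      simpa only [Nat.cast_zero, zero_mul, neg_zero, Real.exp_zero] using
        nu_mul_translate_le φ χ x k 0⟩

lemma mul_conj_apply (ψ : KOne n) (t : EuclideanSpace ℝ (Fin n)) :
    (ψ * conj ψ) t = ((‖ψ t‖ ^ 2 : ℝ) : ℂ) := by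
  rw [mul_apply, conj_apply, Complex.mul_conj', Complex.ofReal_pow]

lemma integral_mul_conj_ne_zero {ψ : KOne n} (hψ : ψ ≠ 0) : ∫ t, (ψ * conj ψ) t ≠ 0 := by
  obtain ⟨t₀, ht₀⟩ : ∃ t, ψ t ≠ 0 := by
    by_contra! hzero
    exact hψ (Subtype.ext (funext hzero))
  have hint : Integrable fun t => ‖ψ t‖ ^ 2 := by
    refine (integrable_coe (ψ * conj ψ)).norm.congr (ae_of_all _ fun t => ?_)
    simp [mul_conj_apply]
  have hpos : 0 < ∫ t, ‖ψ t‖ ^ 2 := integral_pos_of_integrable_nonneg_nonzero (x := t₀)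
    (ψ.2.1.continuous.norm.pow 2) hint (fun t => by positivity)
    (pow_ne_zero 2 (norm_ne_zero_iff.2 ht₀))
  simp only [mul_conj_apply, integral_complex_ofReal]
  exact_mod_cast hpos.ne'

lemma integral_mul_dual_apply (f : KOneDual n) (φ χ : KOne n) :
    (∫ t, χ t) * f φ = ∫ x, f (φ * translate x χ) := by
  rw [← smul_eq_mul, ← map_smul]
  have hcont := continuous_mul_translate φ χ
  refine dual_apply_eq_integral f hcont (fun k => ?_) fun t => ?_
  · refine ((integrable_exp_neg_mul_norm one_pos).const_mul
      ((2 * (n + 1)) ^ k * (nu n (k + 1) φ * nu n (k + 1) χ))).mono'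
      (((withSeminorms_nu n).continuous_seminorm k).comp hcont).aestronglyMeasurable
      (ae_of_all _ fun x => ?_)
    rw [Real.norm_of_nonneg (apply_nonneg _ _)]
    exact_mod_cast nu_mul_translate_le φ χ x k 1
  · simp only [mul_apply, translate_apply]
    rw [integral_const_mul, integral_sub_left_eq_self (fun t => χ t) volume t, mul_comm]
    rfl

/-- The function `t ↦ e^{-2πη·t} φ(t) ψ(t - x)`, whose inverse Fourier transform gives the
coefficients in the reconstruction formula on `ℝⁿ × (ℝⁿ + iη)`. -/
def synthesisWindow (η : EuclideanSpace ℝ (Fin n)) (φ ψ : KOne n)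
    (x : EuclideanSpace ℝ (Fin n)) : KOne n :=
  expMul (-phase (complexPoint 0 η)) φ * translate x ψ

lemma integral_fourierInv_synthesisWindow_mul_stftAtom (η : EuclideanSpace ℝ (Fin n))
    (φ ψ : KOne n) (x t : EuclideanSpace ℝ (Fin n)) :
    ∫ ξ, 𝓕⁻ (toSchwartz (synthesisWindow η φ ψ x)) ξ * stftAtom ψ x (complexPoint ξ η) t =
      (φ * translate x (ψ * conj ψ)) t := by
  let g := synthesisWindow η φ ψ x
  calc ∫ ξ, 𝓕⁻ (toSchwartz g) ξ * stftAtom ψ x (complexPoint ξ η) t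
      = ∫ ξ, Complex.exp ((-2 * Real.pi * inner ℝ t ξ : ℝ) * Complex.I) * 𝓕⁻ (toSchwartz g) ξ *
          (Complex.exp (phase (complexPoint 0 η) t) * conj ψ (t - x)) := by
        refine integral_congr_ae (ae_of_all _ fun ξ => ?_)
        simp only [stftAtom_apply, phase_complexPoint ξ, Complex.exp_add, conj_apply]
        ring
    _ = g t * (Complex.exp (phase (complexPoint 0 η) t) * conj ψ (t - x)) := by
        rw [integral_mul_const, integral_cexp_mul_fourierInv_toSchwartz]
    _ = Complex.exp (-phase (complexPoint 0 η) t + phase (complexPoint 0 η) t) *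
          (φ t * (ψ (t - x) * conj ψ (t - x))) := by
        simp only [g, synthesisWindow, mul_apply, expMul_apply, translate_apply, Complex.exp_add,
          neg_apply]
        ring
    _ = (φ * translate x (ψ * conj ψ)) t := by
        rw [neg_add_cancel, Complex.exp_zero, one_mul]
        rfl

lemma integrable_nu_fourierInv_smul_stftAtom (ψ g : KOne n) (x η : EuclideanSpace ℝ (Fin n))
    (k : ℕ) :
    Integrable fun ξ => nu n k (𝓕⁻ (toSchwartz g) ξ • stftAtom ψ x (complexPoint ξ η)) := by
  obtain ⟨C, hstft⟩ := exists_nu_stftAtom_complexPoint_le ψ x η k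
  obtain ⟨K, D, hD, hdecay⟩ := exists_norm_fourierInv_toSchwartz_le n (k + (n + 1))
  have hint : Integrable fun ξ : EuclideanSpace ℝ (Fin n) => ((1 + ‖ξ‖) ^ (n + 1))⁻¹ :=
    integrable_one_add_norm_pow_inv (by simp)
  refine (hint.const_mul (C * (D * nu n K g))).mono'
    (((withSeminorms_nu n).continuous_seminorm k).comp
      ((𝓕⁻ (toSchwartz g)).continuous.smul (continuous_stftAtom ψ x η))).aestronglyMeasurable
    (ae_of_all _ fun ξ => ?_)
  rw [Real.norm_of_nonneg (apply_nonneg _ _), map_smul_eq_mul]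
  calc _ ≤ D * nu n K g * ((1 + ‖ξ‖) ^ (k + (n + 1)))⁻¹ * (C * (1 + ‖ξ‖) ^ k) := by
        gcongr
        · exact hdecay g ξ
        · exact hstft ξ
    _ = C * (D * nu n K g) * ((1 + ‖ξ‖) ^ (n + 1))⁻¹ := by
        rw [pow_add]
        field_simp

lemma dual_mul_translate_mul_conj_apply (f : KOneDual n) (η : EuclideanSpace ℝ (Fin n))
    (φ ψ : KOne n) (x : EuclideanSpace ℝ (Fin n)) :
    f (φ * translate x (ψ * conj ψ)) =
      ∫ ξ, 𝓕⁻ (toSchwartz (synthesisWindow η φ ψ x)) ξ * stft ψ f x (complexPoint ξ η) := by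
  rw [dual_apply_eq_integral (μ := volume) f
    ((𝓕⁻ (toSchwartz (synthesisWindow η φ ψ x))).continuous.smul (continuous_stftAtom ψ x η))
    (integrable_nu_fourierInv_smul_stftAtom ψ _ x η)
    (integral_fourierInv_synthesisWindow_mul_stftAtom η φ ψ x)]
  simp only [map_smul, smul_eq_mul]
  rfl

theorem integral_mul_dual_apply_eq_integral_stft (f : KOneDual n) (η : EuclideanSpace ℝ (Fin n))
    (φ ψ : KOne n) :
    (∫ t, (ψ * conj ψ) t) * f φ = ∫ x, ∫ ξ,
      𝓕⁻ (toSchwartz (synthesisWindow η φ ψ x)) ξ * stft ψ f x (complexPoint ξ η) := by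
  simp only [integral_mul_dual_apply, dual_mul_translate_mul_conj_apply f η]

end Reconstruction

section Bounded

lemma exists_nu_synthesisWindow_le (η : EuclideanSpace ℝ (Fin n)) (ψ : KOne n) (k l : ℕ) :
    ∃ (K : ℕ) (C : ℝ), 0 ≤ C ∧ ∀ φ x,
      nu n k (synthesisWindow η φ ψ x) ≤ C * nu n K φ * Real.exp (-(l * ‖x‖)) := by
  let L := -phase (complexPoint 0 η)
  obtain ⟨K, hkK, hK⟩ := exists_nat_mul_add_re_le L (k + l)
  refine ⟨K, (2 * (n + 1)) ^ k * (‖L‖ + (n + 1)) ^ (k + l) * nu n (k + l) ψ, by positivity,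
    fun φ x => ?_⟩
  calc _ ≤ _ := nu_mul_translate_le (expMul L φ) ψ x k l
    _ ≤ (2 * (n + 1)) ^ k * ((‖L‖ + (n + 1)) ^ (k + l) * nu n K φ * nu n (k + l) ψ) *
          Real.exp (-(l * ‖x‖)) := by
        gcongr
        exact nu_expMul_le L φ hkK hK
    _ = _ := by ring

lemma exists_norm_fourierInv_synthesisWindow_le (η : EuclideanSpace ℝ (Fin n)) (ψ : KOne n)
    (l m : ℕ) :
    ∃ (K : ℕ) (C : ℝ), 0 ≤ C ∧ ∀ φ x ξ, ‖𝓕⁻ (toSchwartz (synthesisWindow η φ ψ x)) ξ‖ ≤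
      C * nu n K φ * (Real.exp (-(l * ‖x‖)) * ((1 + ‖ξ‖) ^ m)⁻¹) := by
  obtain ⟨K₁, D, hD, hfourier⟩ := exists_norm_fourierInv_toSchwartz_le n m
  obtain ⟨K, C, hC, hwindow⟩ := exists_nu_synthesisWindow_le η ψ K₁ l
  refine ⟨K, D * C, by positivity, fun φ x ξ => (hfourier _ ξ).trans ?_⟩
  calc _ ≤ D * (C * nu n K φ * Real.exp (-(l * ‖x‖))) * ((1 + ‖ξ‖) ^ m)⁻¹ := by
        gcongr
        exact hwindow φ x
    _ = _ := by ring

lemma exists_norm_integral_fourierInv_mul_le (η : EuclideanSpace ℝ (Fin n)) (ψ : KOne n) (k : ℕ) :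
    ∃ (K : ℕ) (A : ℝ), ∀ (φ : KOne n) (C : ℝ)
      (V : EuclideanSpace ℝ (Fin n) → EuclideanSpace ℝ (Fin n) → ℂ),
      (∀ x ξ, Real.exp (-(k * ‖x‖)) * ((1 + ‖ξ‖) ^ k)⁻¹ * ‖V x ξ‖ ≤ C) →
        ‖∫ x, ∫ ξ, 𝓕⁻ (toSchwartz (synthesisWindow η φ ψ x)) ξ * V x ξ‖ ≤ C * A * nu n K φ := by
  obtain ⟨K, D, hD, hcoeff⟩ := exists_norm_fourierInv_synthesisWindow_le η ψ (k + 1) (k + (n + 1))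
  refine ⟨K, D * ((∫ x : EuclideanSpace ℝ (Fin n), Real.exp (-(1 * ‖x‖))) *
    ∫ ξ : EuclideanSpace ℝ (Fin n), ((1 + ‖ξ‖) ^ (n + 1))⁻¹), fun φ C V hV => ?_⟩
  refine (norm_integral_integral_le_of_norm_le_mul
    ((integrable_exp_neg_mul_norm one_pos).const_mul (C * (D * nu n K φ)))
    (integrable_one_add_norm_pow_inv (m := n + 1) (by simp)) fun x ξ => ?_).trans_eq ?_
  · calc _ ≤ D * nu n K φ * (Real.exp (-((k + 1 : ℕ) * ‖x‖)) * ((1 + ‖ξ‖) ^ (k + (n + 1)))⁻¹) *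
          ‖V x ξ‖ := by
          rw [norm_mul]
          gcongr
          exact hcoeff φ x ξ
      _ = D * nu n K φ * Real.exp (-(1 * ‖x‖)) * ((1 + ‖ξ‖) ^ (n + 1))⁻¹ *
          (Real.exp (-(k * ‖x‖)) * ((1 + ‖ξ‖) ^ k)⁻¹ * ‖V x ξ‖) := by
          rw [Nat.cast_succ, add_mul, neg_add, Real.exp_add, pow_add, mul_inv]
          ring
      _ ≤ D * nu n K φ * Real.exp (-(1 * ‖x‖)) * ((1 + ‖ξ‖) ^ (n + 1))⁻¹ * C := by
          gcongr
          exact hV x ξ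
      _ = _ := by ring
  · rw [integral_const_mul]
    ring

theorem isVonNBounded_of_stft_bound {ψ : KOne n} (hψ : ψ ≠ 0) {B : Set (KOneDual n)}
    {η : EuclideanSpace ℝ (Fin n)} {k : ℕ} {C : ℝ}
    (hB : ∀ f ∈ B, ∀ x ξ : EuclideanSpace ℝ (Fin n),
      Real.exp (-(k * ‖x‖)) * ((1 + ‖ξ‖) ^ k)⁻¹ * ‖stft ψ f x (complexPoint ξ η)‖ ≤ C) :
    Bornology.IsVonNBounded ℂ B := by
  obtain ⟨K, A, hA⟩ := exists_norm_integral_fourierInv_mul_le η ψ k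
  have hnorm : 0 < ‖∫ t, (ψ * conj ψ) t‖ := norm_pos_iff.2 (integral_mul_conj_ne_zero hψ)
  refine isVonNBounded_of_norm_apply_le (withSeminorms_nu n) (i := K)
    (C := C * A / ‖∫ t, (ψ * conj ψ) t‖) fun f hf φ => ?_
  rw [div_mul_eq_mul_div, le_div_iff₀' hnorm, ← norm_mul,
    integral_mul_dual_apply_eq_integral_stft f η]
  exact hA φ C _ (hB f hf)

end Bounded

end ExpType

end

theorem mainTheorem8 (n : ℕ) (B : Set (ExpType.KOneDual n)) (ψ : ExpType.KOne n) (hψ : ψ ≠ 0) :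
    ((∃ (η : EuclideanSpace ℝ (Fin n)) (k : ℕ) (C : ℝ),
        ∀ f ∈ B, ∀ x ξ : EuclideanSpace ℝ (Fin n),
          Real.exp (-(k * ‖x‖)) * ((1 + ‖ξ‖) ^ k)⁻¹ * ‖ExpType.stft ψ f x (ExpType.complexPoint ξ η)‖ ≤ C) →
      Bornology.IsVonNBounded ℂ B) ∧
    (Bornology.IsVonNBounded ℂ B →
      ∃ k : ℕ, ∀ r : ℝ, 0 ≤ r → ∃ C : ℝ,
        ∀ f ∈ B, ∀ x : EuclideanSpace ℝ (Fin n), ∀ z ∈ ExpType.tube n r,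
          Real.exp (-(k * ‖x‖) - 2 * Real.pi * inner ℝ x (ExpType.imPart z)) * ((1 + ‖z‖) ^ k)⁻¹ *
            ‖ExpType.stft ψ f x z‖ ≤ C) :=
  ⟨fun ⟨_, _, _, hB⟩ => ExpType.isVonNBounded_of_stft_bound hψ hB, fun hB =>
    let ⟨k, hk⟩ := ExpType.stft_bound_of_isVonNBounded ψ hB
    ⟨k, fun r _ => hk r⟩⟩
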